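/- Let $C=(C_{ij})_{0\le i,j\le n}$ be an indecomposable Cartan matrix of non-twisted affine type, $I=\{1,\dots,n\}$, let $d_i$ be the relatively prime positive integers such that $(d_iC_{ij})$ is symmetric, let $q\in\mathbb C^\times$ not be a root of unity, and put $q_i=q^{d_i}$. Let $U_q(\mathfrak g)$ be the quantum loop algebra, with its Drinfeld generators $x^\pm_{i,r}$ ($r\in\mathbb Z$), $\phi^\pm_{i,\pm m}$ ($m\ge 0$), $k_i^{\pm1}$ ($i\in I$), and let $U_q(\mathfrak b)\subset U_q(\mathfrak g)$ be the Borel algebra, i.e. the subalgebra generated by $k_i^{\pm1}$, $e_i=x^+_{i,0}$ ($i\in I$) and $$e_0=[\tilde x^-_{i_1,0},[\tilde x^-_{i_2,0},\cdots,[\tilde x^-_{i_k,0},\tilde x^-_{j_0,1}]_q\cdots]_q]_q,\qquad \tilde x^-_{i,r}=k_i^{-1}x^-_{i,r},$$ where $[A,B]_q=AB-q^{(\alpha,\beta)}BA$ for $A,B$ of weights $\alpha,\beta$, and where $i_1,\dots,i_k,j_0\in I$ are such that the commutator $[\dot x^+_{i_1},[\dot x^+_{i_2},\cdots,[\dot x^+_{i_k},\dot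 x^+_{j_0}]\cdots]]$ of simple root vectors is a non-zero maximal root vector of the simple Lie algebra with Cartan matrix $(C_{ij})_{i,j\in I}$. Put $\mathfrak t^*=(\mathbb C^\times)^I$, $\overline\alpha_i=(q_i^{C_{ij}})_{j\in I}\in\mathfrak t^*$, and write $\omega\le\omega'$ if $\omega\omega'^{-1}$ is a product of elements $\overline\alpha_i^{-1}$. For a $U_q(\mathfrak b)$-module $V$ and $\omega\in\mathfrak t^*$ let $V_\omega=\{v\in V: k_iv=\omega(i)v\ \forall i\in I\}$. The module $V$ is in category $\mathcal O$ if $V=\bigoplus_\omega V_\omega$, all $V_\omega$ are finite-dimensional, and there are finitely many $\lambda_1,\dots,\lambda_s\in\mathfrak t^*$ such that every $\omega$ with $V_\omega\ne0$ satisfies $\omega\le\lambda_j$ for some $j$. An $\ell$-weight is a family $\Psi=(\Psi_i(z))_{i\in I}$ of power series $\Psi_i(z)=\sum_{m\ge0}\Psi_{i,m}z^m\in\mathbb C[[z]]$ with $\Psi_{i,0}\neq0$; its $\ell$-weight space is $$V_\Psi=\{v\in V:\ \exists p\ge0\ \forall i\in I\ \forall m\ge0,\ (\phi^+_{i,m}-\Psi_{i,m})^pv=0\}.$$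 Let $V$ be a $U_q(\mathfrak b)$-module and let $\Psi$ be an $\ell$-weight with $V_\Psi\ne0$. (1) Let $i\in I$ and let $\omega=(\Psi_{j,0})_{j\in I}$. If $V_\omega$, $V_{\omega\overline\alpha_i}$ and $V_{\omega\overline\alpha_i^{-1}}$ are finite-dimensional, then $\Psi_i(z)$ is rational, i.e. the expansion at $0$ of a rational function. (2) If $V$ is in category $\mathcal O$, then $\Psi_i(z)$ is rational for every $i\in I$. -/

import Mathlib

open scoped BigOperators

namespace QuantumLoop

noncomputable section

/-! ### `q`-integers -/

/-- The `q`-integer `[m]_z = (z ^ m - z ^ (-m)) / (z - z⁻¹)`. -/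
def qInt (z : ℂ) (m : ℕ) : ℂ := (z ^ m - (z⁻¹) ^ m) / (z - z⁻¹)

/-- The `q`-factorial `[m]_z! = [1]_z [2]_z ⋯ [m]_z`. -/
def qFactorial (z : ℂ) (m : ℕ) : ℂ := ∏ j ∈ Finset.range m, qInt z (j + 1)

/-- The `q`-binomial coefficient (used for `r ≤ s` only). -/
def qBinom (z : ℂ) (s r : ℕ) : ℂ :=
  qFactorial z s / (qFactorial z r * qFactorial z (s - r))

/-! ### The quantum loop algebra in its Drinfeld realization -/

/-- The generators of the quantum loop algebra; signs `±` are units `ε : ℤˣ`.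
* `x ε i r` is `x̃^ε_{i,r}`;
* `phiP i m` is `φ̃⁺_{i,m}` and `phiM i m` is `φ̃⁻_{i,-m}`, for `m ≥ 0`;
* `kap i` is `κ_i` and `kapInv i` is its inverse. -/
inductive Gen (I : Type*) : Type _
  | x (ε : ℤˣ) (i : I) (r : ℤ) : Gen I
  | phiP (i : I) (m : ℕ) : Gen I
  | phiM (i : I) (m : ℕ) : Gen I
  | kap (i : I) : Gen I
  | kapInv (i : I) : Gen I

section Free

variable {I : Type*}

/-- The free generator `x̃^ε_{i,r}`. -/
def fx (ε : ℤˣ) (i : I) (r : ℤ) : FreeAlgebra ℂ (Gen I) := FreeAlgebra.ι ℂ (Gen.x ε i r)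

/-- The free generator `φ̃⁺_{i,m}`. -/
def fphiP (i : I) (m : ℕ) : FreeAlgebra ℂ (Gen I) := FreeAlgebra.ι ℂ (Gen.phiP i m)

/-- The free generator `φ̃⁻_{i,-m}`. -/
def fphiM (i : I) (m : ℕ) : FreeAlgebra ℂ (Gen I) := FreeAlgebra.ι ℂ (Gen.phiM i m)

/-- The free generator `κ_i`. -/
def fkap (i : I) : FreeAlgebra ℂ (Gen I) := FreeAlgebra.ι ℂ (Gen.kap i)

/-- The free generator `κ_i⁻¹`. -/
def fkapInv (i : I) : FreeAlgebra ℂ (Gen I) := FreeAlgebra.ι ℂ (Gen.kapInv i)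

/-- `φ̃⁺_{i,n}` for every integer `n`; it is `0` for `n < 0`. -/
def fphiPZ (i : I) (n : ℤ) : FreeAlgebra ℂ (Gen I) := if 0 ≤ n then fphiP i n.toNat else 0

/-- `φ̃⁻_{i,n}` for every integer `n`; it is `0` for `n > 0`. -/
def fphiMZ (i : I) (n : ℤ) : FreeAlgebra ℂ (Gen I) := if n ≤ 0 then fphiM i (-n).toNat else 0

/-- The left hand side of the Drinfeld-Serre relation for `i ≠ j`, with `s = 1 - C_{ij}`:
the sum over `π ∈ Σ_s` and `0 ≤ k ≤ s` of
`(-1)^k [s choose k]_z x_{i,r_{π(1)}} ⋯ x_{i,r_{π(k)}} x_{j,r'} x_{i,r_{π(k+1)}} ⋯ x_{i,r_{π(s)}}`. -/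
def serreSum (z : ℂ) (ε : ℤˣ) (i j : I) (s : ℕ) (r : Fin s → ℤ) (r' : ℤ) :
    FreeAlgebra ℂ (Gen I) :=
  ∑ π : Equiv.Perm (Fin s), ∑ k ∈ Finset.range (s + 1),
    ((-1) ^ k * qBinom z s k) •
      (((List.ofFn fun t => fx ε i (r (π t))).take k).prod * fx ε j r' *
        ((List.ofFn fun t => fx ε i (r (π t))).drop k).prod)

end Free

variable {I : Type*} (C : Matrix I I ℤ) (d : I → ℕ) (q : ℂ)

/-- `q_i ^ (n C_{ij})`, where `q_i = q ^ d_i`. -/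
def qpow (i j : I) (n : ℤ) : ℂ := (q ^ d i) ^ (n * C i j)

/-- The defining relations of the quantum loop algebra in terms of the generators
`x̃^±_{i,r}`, `φ̃^±_{i,±m}`, `κ_i^{±1}`. -/
inductive Rel : FreeAlgebra ℂ (Gen I) → FreeAlgebra ℂ (Gen I) → Prop
  | kap_mul_inv (i : I) : Rel (fkap i * fkapInv i) 1
  | inv_mul_kap (i : I) : Rel (fkapInv i * fkap i) 1
  | kap_comm (i j : I) : Rel (fkap i * fkap j) (fkap j * fkap i)
  | kap_phiP (i j : I) (m : ℕ) : Rel (fkap i * fphiP j m) (fphiP j m * fkap i)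
  | kap_phiM (i j : I) (m : ℕ) : Rel (fkap i * fphiM j m) (fphiM j m * fkap i)
  | phiP_zero (i : I) : Rel (fphiP i 0) 1
  | phiM_zero (i : I) : Rel (fphiM i 0) (fkap i ^ 2)
  | phiP_phiP (i j : I) (m m' : ℕ) : Rel (fphiP i m * fphiP j m') (fphiP j m' * fphiP i m)
  | phiM_phiM (i j : I) (m m' : ℕ) : Rel (fphiM i m * fphiM j m') (fphiM j m' * fphiM i m)
  | phiP_phiM (i j : I) (m m' : ℕ) : Rel (fphiP i m * fphiM j m') (fphiM j m' * fphiP i m)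
  | kap_x (ε : ℤˣ) (i j : I) (r : ℤ) :
      Rel (fkap i * fx ε j r) (qpow C d q i j (-ε) • (fx ε j r * fkap i))
  | phiP_x (ε : ℤˣ) (i j : I) (m : ℕ) (r : ℤ) :
      Rel (fphiP i m * fx ε j r)
        (∑ l ∈ Finset.range (m + 1),
            qpow C d q i j (ε * l) • (fx ε j (r + l) * fphiP i (m - l)) -
          ∑ l ∈ Finset.range m,
            qpow C d q i j (ε * ((l : ℤ) - 1)) • (fx ε j (r + l + 1) * fphiP i (m - l - 1)))
  | phiM_x (ε : ℤˣ) (i j : I) (m : ℕ) (r : ℤ) :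
      Rel (fphiM i m * fx ε j r)
        (-(∑ l ∈ Finset.range m,
            qpow C d q i j (-ε * ((l : ℤ) + 1)) • (fx ε j (r - l - 1) * fphiM i (m - l - 1))) +
          ∑ l ∈ Finset.range (m + 1),
            qpow C d q i j (-ε * ((l : ℤ) + 2)) • (fx ε j (r - l) * fphiM i (m - l)))
  | xP_xM_same (i : I) (r r' : ℤ) :
      Rel (qpow C d q i i (-1) • (fx 1 i r * fx (-1) i r') - fx (-1) i r' * fx 1 i r)
        ((q ^ d i - (q ^ d i)⁻¹)⁻¹ • (fphiPZ i (r + r') - fphiMZ i (r + r')))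
  | xP_xM_ne (i j : I) (r r' : ℤ) (hij : i ≠ j) :
      Rel (qpow C d q i j (-1) • (fx 1 i r * fx (-1) j r') - fx (-1) j r' * fx 1 i r) 0
  | x_x (ε : ℤˣ) (i j : I) (r r' : ℤ) :
      Rel (fx ε i (r + 1) * fx ε j r' - qpow C d q i j ε • (fx ε j r' * fx ε i (r + 1)))
        (qpow C d q i j ε • (fx ε i r * fx ε j (r' + 1)) - fx ε j (r' + 1) * fx ε i r)
  | serre (ε : ℤˣ) (i j : I) (hij : i ≠ j) (r : Fin (1 - C i j).toNat → ℤ) (r' : ℤ) :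
      Rel (serreSum (q ^ d i) ε i j (1 - C i j).toNat r r') 0

/-- The quantum loop algebra `U_q(𝔤)` in its Drinfeld realization, for the untwisted affine
algebra `𝔤` whose underlying finite Cartan matrix is `C = (C_{ij})_{i,j ∈ I}`, with symmetrizing
integers `d`. -/
def LoopAlgebra : Type _ := RingQuot (Rel C d q)

instance : Ring (LoopAlgebra C d q) := inferInstanceAs (Ring (RingQuot (Rel C d q)))

instance : Algebra ℂ (LoopAlgebra C d q) := inferInstanceAs (Algebra ℂ (RingQuot (Rel C d q)))

/-- The quotient map from the free algebra. -/
def LoopAlgebra.mk : FreeAlgebra ℂ (Gen I) →ₐ[ℂ] LoopAlgebra C d q := RingQuot.mkAlgHom ℂ (Rel C d q)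

/-- The element `x̃⁺_{i,r} = x⁺_{i,r}`. -/
def xPlus (i : I) (r : ℤ) : LoopAlgebra C d q := LoopAlgebra.mk C d q (fx 1 i r)

/-- The element `x̃⁻_{i,r} = κ_i x⁻_{i,r}`. -/
def xTildeMinus (i : I) (r : ℤ) : LoopAlgebra C d q := LoopAlgebra.mk C d q (fx (-1) i r)

/-- The element `k_i = κ_i⁻¹`. -/
def k (i : I) : LoopAlgebra C d q := LoopAlgebra.mk C d q (fkapInv i)

/-- The element `k_i⁻¹ = κ_i`. -/
def kInv (i : I) : LoopAlgebra C d q := LoopAlgebra.mk C d q (fkap i)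

/-- The Drinfeld generator `φ⁺_{i,m} = κ_i⁻¹ φ̃⁺_{i,m}`. -/
def phiPlus (i : I) (m : ℕ) : LoopAlgebra C d q :=
  LoopAlgebra.mk C d q (fkapInv i * fphiP i m)

/-- The iterated `q`-commutator
`[x̃⁻_{i₁,0}, [x̃⁻_{i₂,0}, ⋯, [x̃⁻_{i_k,0}, x̃⁻_{j₀,1}]_q ⋯ ]_q]_q` attached to the list
`i₁, …, i_k` and to `j₀`. Here `[A, B]_q = A B - q^{(α, β)} B A` for `A` of weight `α` and `B` of
weight `β`, and `(α_i, α_s) = d_i C_{is}`; the two weights are `-α_{i₁}` and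
`-(α_{i₂} + ⋯ + α_{i_k} + α_{j₀})`. -/
def iteratedBracket : List I → I → LoopAlgebra C d q
  | [], j₀ => xTildeMinus C d q j₀ 1
  | i :: l, j₀ =>
      xTildeMinus C d q i 0 * iteratedBracket l j₀ -
        q ^ ((l ++ [j₀]).map fun s => (d i : ℤ) * C i s).sum •
          (iteratedBracket l j₀ * xTildeMinus C d q i 0)

/-- The Borel algebra `U_q(𝔟)`: the subalgebra generated by the Chevalley generators
`e_i = x⁺_{i,0}` and `k_i^{±1}`, `i ∈ I`, and by `e_0`, the iterated `q`-commutator attached to an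
expression of the maximal root vector (see `IsMaximalRootWord`). The remaining generators
`k_0^{±1}` are products of the `k_i^{±1}`, `i ∈ I`. -/
def borel (l : List I) (j₀ : I) : Subalgebra ℂ (LoopAlgebra C d q) :=
  Algebra.adjoin ℂ
    (Set.range (fun i => xPlus C d q i 0) ∪ Set.range (k C d q) ∪ Set.range (kInv C d q) ∪
      {iteratedBracket C d q l j₀})

/-! ### Weights -/

/-- The weight `ᾱ_i ∈ 𝔱^* = (ℂˣ)^I` of the simple root `α_i`: `ᾱ_i(j) = q_i ^ C_{ij}`. -/
def simpleWeight (q : ℂˣ) (i : I) : I → ℂˣ := fun j => (q ^ d i) ^ C i j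

/-- The partial order on `𝔱^*`: `ω ≤ ω'` if `ω ω'⁻¹` is a product of elements `ᾱ_i⁻¹`. -/
def WeightLE [Fintype I] (q : ℂˣ) (ω ω' : I → ℂˣ) : Prop :=
  ∃ n : I → ℕ, ω * ω'⁻¹ = ∏ i, ((simpleWeight C d q i)⁻¹) ^ n i

end

noncomputable section

variable {I : Type*} (C : Matrix I I ℤ) (d : I → ℕ) (q : ℂˣ) (l : List I) (j₀ : I)

/-- `k_i` as an element of the Borel algebra. -/
def kBorel (i : I) : borel C d (q : ℂ) l j₀ :=
  ⟨k C d q i, Algebra.subset_adjoin (Or.inl (Or.inl (Or.inr ⟨i, rfl⟩)))⟩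

variable (V : Type*) [AddCommGroup V] [Module ℂ V] [Module (borel C d (q : ℂ) l j₀) V]
  [IsScalarTower ℂ (borel C d (q : ℂ) l j₀) V]

/-- The weight space `V_ω = {v | k_i v = ω(i) v for all i ∈ I}`. -/
def weightSpace (ω : I → ℂˣ) : Submodule ℂ V where
  carrier := {v | ∀ i, kBorel C d q l j₀ i • v = (ω i : ℂ) • v}
  zero_mem' := by simp
  add_mem' := by
    intro v w hv hw i
    rw [smul_add, smul_add, hv i, hw i]
  smul_mem' := by
    intro c v hv i
    have := smul_algebra_smul_comm c (kBorel C d q l j₀ i) v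
    rw [this, hv i, smul_comm]

/-- Category `𝒪` for `U_q(𝔟)`. -/
structure InCategoryO [Fintype I] : Prop where
  /-- The weight spaces are independent. -/
  independent : iSupIndep (weightSpace C d q l j₀ V)
  /-- The weight spaces span `V`. -/
  span : ⨆ ω, weightSpace C d q l j₀ V ω = ⊤
  /-- The weight spaces are finite dimensional. -/
  finite (ω : I → ℂˣ) : FiniteDimensional ℂ (weightSpace C d q l j₀ V ω)
  /-- The weights lie in a finite union of cones `D(λ) = {ω | ω ≤ λ}`. -/
  bounded : ∃ S : Finset (I → ℂˣ), ∀ ω, weightSpace C d q l j₀ V ω ≠ ⊥ →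
    ∃ μ ∈ S, WeightLE C d q ω μ

/-- The `ℓ`-weight space
`V_Ψ = {v | ∃ p, ∀ i m, (φ⁺_{i,m} - Ψ_{i,m})^p v = 0}`. The Drinfeld generator `φ⁺_{i,m}` acts on
`V` as the element `b` of `U_q(𝔟)` whose image in `U_q(𝔤)` is `φ⁺_{i,m}`. -/
def lWeightSpace (Ψ : I → PowerSeries ℂ) : Submodule ℂ V where
  carrier := {v | ∃ p : ℕ, ∀ (i : I) (m : ℕ) (b : borel C d (q : ℂ) l j₀),
    (b : LoopAlgebra C d (q : ℂ)) = phiPlus C d q i m →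
      (b - algebraMap ℂ _ (PowerSeries.coeff m (Ψ i))) ^ p • v = 0}
  zero_mem' := ⟨0, by simp⟩
  add_mem' := by
    rintro v w ⟨p, hp⟩ ⟨p', hp'⟩
    refine ⟨p + p', fun i m b hb => ?_⟩
    have h1 := hp i m b hb
    have h2 := hp' i m b hb
    rw [smul_add, add_comm p p', pow_add, mul_smul, h1, ← pow_add, add_comm p' p, pow_add,
      mul_smul, h2]
    simp
  smul_mem' := by
    rintro c v ⟨p, hp⟩
    refine ⟨p, fun i m b hb => ?_⟩
    rw [smul_algebra_smul_comm, hp i m b hb, smul_zero]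

end

/-- A formal power series over `ℂ` is (the expansion at `0` of) a rational function. -/
def IsRational (f : PowerSeries ℂ) : Prop :=
  ∃ P Q : Polynomial ℂ, Q ≠ 0 ∧ (Q : PowerSeries ℂ) * f = (P : PowerSeries ℂ)

/-- An `ℓ`-weight: a family of power series with non-zero constant terms. -/
def IsLWeight {I : Type*} (Ψ : I → PowerSeries ℂ) : Prop :=
  ∀ i, PowerSeries.constantCoeff (Ψ i) ≠ 0

/-- The integers `d_i` are positive, relatively prime, and `(d_i C_{ij})` is symmetric. -/
structure IsSymmetrizer {I : Type*} (C : Matrix I I ℤ) (d : I → ℕ) : Prop where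
  pos (i : I) : 0 < d i
  symm (i j : I) : (d i : ℤ) * C i j = d j * C j i
  coprime (n : ℕ) (hn : ∀ i, n ∣ d i) : n = 1

section RootSystem

variable {ι M N : Type*} [AddCommGroup M] [Module ℂ M] [AddCommGroup N] [Module ℂ N]
  {P : RootPairing ι ℂ M N}

/-- The sum of simple roots `α_{i₁} + ⋯ + α_{i_k} + α_{j₀}`. -/
def wordRoot (b : P.Base) (l : List b.support) (j₀ : b.support) : M :=
  (l.map fun i => P.root i).sum + P.root j₀

/-- The commutator `[ẋ⁺_{i₁}, [ẋ⁺_{i₂}, ⋯, [ẋ⁺_{i_k}, ẋ⁺_{j₀}] ⋯ ]]` of simple root vectors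
of the simple Lie algebra is a non-zero multiple of the maximal root vector: as
`[𝔤_α, 𝔤_β] = 𝔤_{α + β}` for roots `α`, `β` with `α + β ≠ 0` (where `𝔤_γ = 0` if `γ` is not a
root), this means that all the partial sums are roots and that the total sum is the highest
root. -/
structure IsMaximalRootWord (b : P.Base) (l : List b.support) (j₀ : b.support) : Prop where
  isRoot (l' : List b.support) (hl' : l' <:+ l) : wordRoot b l' j₀ ∈ Set.range P.root
  highest (a : ι) : wordRoot b l j₀ - P.root a ∈ AddSubmonoid.closure (P.root '' b.support)

end RootSystem

end QuantumLoop

/-! Rationality is linear algebra once `U_q(𝔟)` is known to contain `x⁺_{i,r}` for `r ≥ 0`,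
`x̃⁻_{i,r}` for `r ≥ 1` and all `φ⁺_{i,m}`. The operators `x̃⁻_{i,r+1}` map `V_{ωᾱ_i}` to `V_ω` and
`V_ω` to `V_{ωᾱ_i⁻¹}`. These spaces are finite-dimensional, so some non-trivial finite combination
`∑ c_r x̃⁻_{i,r+1}` vanishes on both sources. Up to a scalar, `φ⁺_{i,s+r+1}` is `k_i` times a
`q`-commutator of `x⁺_{i,s}` and `x̃⁻_{i,r+1}`, so `∑ c_r φ⁺_{i,s+r+1}` kills `V_ω` for every `s`.
On a joint eigenvector this is a linear recurrence for the coefficients of `Ψ_i`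
(`isRational_of_finiteDimensional`, `isRational_of_recurrence`).

The bulk of the proof shows that `x̃⁻_{i,1}` lies in `U_q(𝔟)`; the other elements follow by
commutators. The element `e₀` is obtained from `x̃⁻_{j₀,1}` by adjoint actions `adF` of the
`x̃⁻_{i,0}`, and the adjoint actions `adE` of the `x⁺_{i,0}` preserve `U_q(𝔟)`, so the task is to
descend from `e₀` with `adE`. For each `i`, the operators `adE`, `adF` form a quantum `𝔰𝔩₂` acting
on the spans of iterated brackets (`wordSpace`), with `adF` locally nilpotent. String arguments and
induction on the height show that these spaces are lines for positive roots and zero otherwise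
(`wordSpace_spec`), and that `adE` is onto between neighbouring positive roots (`wordSpace_map`).
Any positive root is reached from the highest one by subtracting simple roots through roots
(`exists_add_single_mem`), which gives the descent (`wordSpace_le_borel`).

The induction assumes that no `x̃⁻_{j,1}` is zero. If one vanishes, then all do by connectedness
(`xTildeMinus_one_eq_zero`), and membership is trivial. -/

namespace QuantumLoop

noncomputable section

/-! ### Drinfeld relations as identities in the quotient algebra. -/

section Relations

variable {I : Type*} (C : Matrix I I ℤ) (d : I → ℕ) (q : ℂ)

/-- The element `φ̃⁺_{i,m}`. -/
def phiTilde (i : I) (m : ℕ) : LoopAlgebra C d q := LoopAlgebra.mk C d q (fphiP i m)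

lemma mk_eq_of_rel {a b : FreeAlgebra ℂ (Gen I)} (h : Rel C d q a b) :
    LoopAlgebra.mk C d q a = LoopAlgebra.mk C d q b :=
  RingQuot.mkAlgHom_rel ℂ h

lemma kInv_mul_k (i : I) : kInv C d q i * k C d q i = 1 := by
  simpa [k, kInv] using mk_eq_of_rel C d q (.kap_mul_inv i)

lemma k_mul_kInv (i : I) : k C d q i * kInv C d q i = 1 := by
  simpa [k, kInv] using mk_eq_of_rel C d q (.inv_mul_kap i)

lemma kInv_comm (i j : I) : kInv C d q i * kInv C d q j = kInv C d q j * kInv C d q i := by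
  simpa [kInv] using mk_eq_of_rel C d q (.kap_comm i j)

lemma kInv_phiTilde (i j : I) (m : ℕ) :
    kInv C d q i * phiTilde C d q j m = phiTilde C d q j m * kInv C d q i := by
  simpa [kInv, phiTilde] using mk_eq_of_rel C d q (.kap_phiP i j m)

lemma phiTilde_zero (i : I) : phiTilde C d q i 0 = 1 := by
  simpa [phiTilde] using mk_eq_of_rel C d q (.phiP_zero i)

lemma phiTilde_comm (i j : I) (m m' : ℕ) :
    phiTilde C d q i m * phiTilde C d q j m' = phiTilde C d q j m' * phiTilde C d q i m := by
  simpa [phiTilde] using mk_eq_of_rel C d q (.phiP_phiP i j m m')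

lemma phiPlus_eq (i : I) (m : ℕ) : phiPlus C d q i m = k C d q i * phiTilde C d q i m := by
  simp [phiPlus, k, phiTilde]

lemma kInv_xPlus (i j : I) (r : ℤ) :
    kInv C d q i * xPlus C d q j r =
      (q ^ d i) ^ (-C i j) • (xPlus C d q j r * kInv C d q i) := by
  simpa [kInv, xPlus, qpow] using mk_eq_of_rel C d q (.kap_x 1 i j r)

lemma kInv_xTildeMinus (i j : I) (r : ℤ) :
    kInv C d q i * xTildeMinus C d q j r =
      (q ^ d i) ^ C i j • (xTildeMinus C d q j r * kInv C d q i) := by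
  simpa [kInv, xTildeMinus, qpow] using mk_eq_of_rel C d q (.kap_x (-1) i j r)

lemma phiTilde_one_xPlus (i j : I) (r : ℤ) :
    phiTilde C d q i 1 * xPlus C d q j r = xPlus C d q j r * phiTilde C d q i 1 +
      ((q ^ d i) ^ C i j - (q ^ d i) ^ (-C i j)) • xPlus C d q j (r + 1) := by
  have h := mk_eq_of_rel C d q (.phiP_x 1 i j 1 r)
  have h0 := phiTilde_zero C d q i
  simp only [phiTilde] at h0
  simp only [map_mul, Finset.sum_range_succ, Finset.sum_range_zero, map_add, map_sub, map_smul,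
    Nat.sub_zero, Nat.sub_self, h0, zero_add, qpow] at h
  simp only [phiTilde, xPlus]
  rw [h]
  simp [sub_smul]
  abel

lemma phiTilde_one_xTildeMinus (i j : I) (r : ℤ) :
    phiTilde C d q i 1 * xTildeMinus C d q j r = xTildeMinus C d q j r * phiTilde C d q i 1 +
      ((q ^ d i) ^ (-C i j) - (q ^ d i) ^ C i j) • xTildeMinus C d q j (r + 1) := by
  have h := mk_eq_of_rel C d q (.phiP_x (-1) i j 1 r)
  have h0 := phiTilde_zero C d q i
  simp only [phiTilde] at h0
  simp only [map_mul, Finset.sum_range_succ, Finset.sum_range_zero, map_add, map_sub, map_smul,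
    Nat.sub_zero, Nat.sub_self, h0, zero_add, qpow] at h
  simp only [phiTilde, xTildeMinus]
  rw [h]
  simp [sub_smul]
  abel

lemma xPlus_xTildeMinus_of_pos (i : I) (r r' : ℤ) (h : 0 < r + r') :
    (q ^ d i) ^ (-C i i) • (xPlus C d q i r * xTildeMinus C d q i r') -
        xTildeMinus C d q i r' * xPlus C d q i r =
      (q ^ d i - (q ^ d i)⁻¹)⁻¹ • phiTilde C d q i (r + r').toNat := by
  have := mk_eq_of_rel C d q (.xP_xM_same i r r')
  simpa [xPlus, xTildeMinus, phiTilde, qpow, fphiPZ, fphiMZ, h.le, h.not_ge] using this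

lemma xPlus_xTildeMinus_zero (i : I) :
    (q ^ d i) ^ (-C i i) • (xPlus C d q i 0 * xTildeMinus C d q i 0) -
        xTildeMinus C d q i 0 * xPlus C d q i 0 =
      (q ^ d i - (q ^ d i)⁻¹)⁻¹ • (1 - kInv C d q i ^ 2) := by
  have := mk_eq_of_rel C d q (.xP_xM_same i 0 0)
  have h0 := mk_eq_of_rel C d q (.phiP_zero i)
  have h1 := mk_eq_of_rel C d q (.phiM_zero i)
  simpa [xPlus, xTildeMinus, kInv, qpow, fphiPZ, fphiMZ, h0, h1] using this

lemma xPlus_xTildeMinus_of_ne {i j : I} (hij : i ≠ j) (r r' : ℤ) :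
    (q ^ d i) ^ (-C i j) • (xPlus C d q i r * xTildeMinus C d q j r') =
        xTildeMinus C d q j r' * xPlus C d q i r := by
  have := mk_eq_of_rel C d q (.xP_xM_ne i j r r' hij)
  rw [map_zero, map_sub, sub_eq_zero] at this
  simpa [xPlus, xTildeMinus, qpow] using this

lemma xTildeMinus_self (i : I) (hC : C i i = 2) :
    xTildeMinus C d q i 1 * xTildeMinus C d q i 0 =
      (q ^ d i) ^ (-2 : ℤ) • (xTildeMinus C d q i 0 * xTildeMinus C d q i 1) := by
  have := mk_eq_of_rel C d q (.x_x (-1) i i 0 0)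
  simp only [map_sub, map_mul, map_smul, qpow, hC, zero_add] at this
  simp only [xTildeMinus]
  norm_num at this ⊢
  -- For `i = j` and `r = r' = 0` the two sides of the quadratic relation are opposite to each
  -- other, so the relation says that twice the left side vanishes.
  have h2 : ∀ a b : LoopAlgebra C d q, ∀ c : ℂ, a - c • b = c • b - a → a = c • b := by
    intro a b c h
    have h3 : (2 : ℂ) • (a - c • b) = 0 := by rw [two_smul]; nth_rw 2 [h]; abel
    simpa [sub_eq_zero] using h3
  exact h2 _ _ _ this

end Relations

/-! ### Twisted commutators, i.e. the adjoint action for the coproduct `a ↦ a ⊗ 1 + g ⊗ a`. -/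

section TwistedCommutator

variable {A : Type*} [Ring A] [Algebra ℂ A]

/-- The twisted commutator `Y ↦ a Y - g Y g' a`, where `g'` is meant to be the inverse of `g`. -/
def twistedAd (g g' a : A) : A →ₗ[ℂ] A :=
  LinearMap.mulLeft ℂ a - LinearMap.mulLeft ℂ g ∘ₗ LinearMap.mulRight ℂ (g' * a)

lemma twistedAd_apply (g g' a Y : A) : twistedAd g g' a Y = a * Y - g * Y * (g' * a) := by
  simp [twistedAd, mul_assoc]

lemma twistedAd_of_conj {g g' a Y : A} {t : ℂ} (hg : g * g' = 1) (hY : g * Y = t • (Y * g)) :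
    twistedAd g g' a Y = a * Y - t • (Y * a) := by
  rw [twistedAd_apply, hY, smul_mul_assoc, mul_assoc, ← mul_assoc g, hg, one_mul]

/-- A relation `p a x - x a = D` passes to the adjoint action: the right side is the action of `D`,
twisted by conjugation with `g h`, whose inverse is `h' g'`. -/
lemma twistedAd_comm {g g' h h' a x D : A} {p : ℂ} (hp : p ≠ 0)
    (hg' : g' * g = 1) (hgi : g * g' = 1) (hh' : h' * h = 1) (hhi : h * h' = 1)
    (hgh : g * h = h * g)
    (hx : g * x = p⁻¹ • (x * g)) (ha : h * a = p • (a * h)) (hD : p • (a * x) - x * a = D) (Y : A) :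
    p • twistedAd g g' a (twistedAd h h' x Y) - twistedAd h h' x (twistedAd g g' a Y) =
      D * Y - g * h * Y * (h' * g' * D) := by
  have hx' : x * g' = p⁻¹ • (g' * x) := by
    calc x * g' = g' * (g * x) * g' := by rw [← mul_assoc, hg', one_mul]
      _ = p⁻¹ • (g' * x * (g * g')) := by rw [hx]; simp only [mul_smul_comm, smul_mul_assoc, mul_assoc]
      _ = _ := by rw [hgi, mul_one]
  have ha' : a * h' = p • (h' * a) := by
    calc a * h' = h' * (h * a) * h' := by rw [← mul_assoc, hh', one_mul]
      _ = p • (h' * a * (h * h')) := by rw [ha]; simp only [mul_smul_comm, smul_mul_assoc, mul_assoc]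
      _ = _ := by rw [hhi, mul_one]
  have hgh' : g' * h' = h' * g' := by
    calc g' * h' = h' * (h * g') * h' := by rw [← mul_assoc h', hh', one_mul]
      _ = h' * (g' * (g * h) * g') * h' := by rw [← mul_assoc g', hg', one_mul]
      _ = h' * (g' * h * (g * g')) * h' := by rw [hgh]; simp only [mul_assoc]
      _ = h' * g' * (h * h') := by rw [hgi, mul_one]; simp only [mul_assoc]
      _ = _ := by rw [hhi, mul_one]
  subst hD
  simp only [twistedAd_apply, mul_sub, sub_mul, smul_sub]
  have e1 : h * (a * Y) * (h' * x) = p • (a * (h * Y * (h' * x))) := by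
    rw [← mul_assoc h, ha]; simp only [smul_mul_assoc, mul_assoc]
  have e2 : p • (g * (x * Y) * (g' * a)) = x * (g * Y * (g' * a)) := by
    rw [← mul_assoc g, hx]; simp only [smul_mul_assoc, mul_assoc, smul_smul, mul_inv_cancel₀ hp,
      one_smul]
  have e3 : p • (g * (h * Y * (h' * x)) * (g' * a)) = g * h * Y * (h' * g' * (x * a)) := by
    calc p • (g * (h * Y * (h' * x)) * (g' * a)) = p • (g * h * Y * h' * (x * g') * a) := by
          simp only [mul_assoc]
      _ = _ := by
          rw [hx']
          simp only [mul_smul_comm, smul_mul_assoc, mul_assoc, smul_smul, mul_inv_cancel₀ hp,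
            one_smul]
  have e4 : h * (g * Y * (g' * a)) * (h' * x) = g * h * Y * (h' * g' * (p • (a * x))) := by
    calc h * (g * Y * (g' * a)) * (h' * x) = (h * g) * Y * g' * (a * h') * x := by
          simp only [mul_assoc]
      _ = p • (g * h * Y * (g' * h') * (a * x)) := by
          rw [ha', hgh]
          simp only [mul_smul_comm, smul_mul_assoc, mul_assoc]
      _ = _ := by
          rw [hgh']
          simp only [mul_smul_comm, mul_assoc]
  rw [e1, e2, e3, e4, mul_assoc x a Y, smul_mul_assoc, mul_assoc a x Y]
  abel

lemma conj_twistedAd {g g' a : A} {t : ℂ} (hg' : g' * g = 1) (hg : g * g' = 1)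
    (ha : g * a = t • (a * g)) (Y : A) :
    g * twistedAd g g' a Y * g' = t • twistedAd g g' a (g * Y * g') := by
  simp only [twistedAd_apply, mul_sub, sub_mul, smul_sub]
  congr 1
  · rw [← mul_assoc, ha]
    simp only [smul_mul_assoc, mul_assoc]
  · calc g * (g * Y * (g' * a)) * g' = g * (g * Y * g') * (g' * (g * a)) * g' := by
          rw [← mul_assoc g' g, hg', one_mul]; simp only [mul_assoc]
      _ = t • (g * (g * Y * g') * (g' * a) * (g * g')) := by
          rw [ha]; simp only [mul_smul_comm, smul_mul_assoc, mul_assoc]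
      _ = _ := by rw [hg, mul_one]

/-- The twisted commutator is a skew derivation with respect to conjugation by `g`; this is the
source of the nilpotency on products. -/
lemma twistedAd_mul {g g' a : A} (hg' : g' * g = 1) (Y Z : A) :
    twistedAd g g' a (Y * Z) = twistedAd g g' a Y * Z + g * Y * g' * twistedAd g g' a Z := by
  have : g * (Y * Z) * (g' * a) = g * Y * g' * (g * Z * (g' * a)) := by
    calc g * (Y * Z) * (g' * a) = g * Y * 1 * Z * (g' * a) := by simp only [mul_one, mul_assoc]
      _ = _ := by rw [← hg']; simp only [mul_assoc]
  simp only [twistedAd_apply, mul_sub, sub_mul, this]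
  simp only [mul_assoc]
  abel

lemma twistedAd_pow_conj {g g' a : A} {t : ℂ} (ht : t ≠ 0) (hg' : g' * g = 1) (hg : g * g' = 1)
    (ha : g * a = t • (a * g)) {n : ℕ} {Y : A} (hY : (twistedAd g g' a ^ n) Y = 0) :
    (twistedAd g g' a ^ n) (g * Y * g') = 0 := by
  have key : ∀ n Y, g * (twistedAd g g' a ^ n) Y * g' =
      t ^ n • (twistedAd g g' a ^ n) (g * Y * g') := by
    intro n
    induction n with
    | zero => simp
    | succ n ih =>
      intro Y
      rw [pow_succ, Module.End.mul_apply, ih, conj_twistedAd hg' hg ha, map_smul, smul_smul,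
        ← pow_succ, Module.End.mul_apply]
  have h := key n Y
  rw [hY, mul_zero, zero_mul, eq_comm, smul_eq_zero] at h
  exact h.resolve_left (pow_ne_zero _ ht)

/-- The set of elements on which the twisted commutator with `a` is nilpotent is closed under
products. -/
lemma twistedAd_pow_mul {g g' a : A} {t : ℂ} (ht : t ≠ 0) (hg' : g' * g = 1) (hg : g * g' = 1)
    (ha : g * a = t • (a * g)) (N : ℕ) : ∀ {n m : ℕ} {Y Z : A}, n + m ≤ N →
    (twistedAd g g' a ^ n) Y = 0 → (twistedAd g g' a ^ m) Z = 0 →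
      (twistedAd g g' a ^ N) (Y * Z) = 0 := by
  induction N with
  | zero =>
    intro n m Y Z h hY hZ
    obtain rfl : n = 0 := by omega
    simp_all
  | succ N ih =>
    intro n m Y Z h hY hZ
    rcases n with _ | n
    · have : Y = 0 := by simpa using hY
      simp [this]
    rcases m with _ | m
    · have : Z = 0 := by simpa using hZ
      simp [this]
    rw [pow_succ, Module.End.mul_apply, twistedAd_mul hg', map_add,
      ih (n := n) (m := m + 1) (by omega) (by rwa [pow_succ, Module.End.mul_apply] at hY) hZ,
      ih (n := n + 1) (m := m) (by omega) (twistedAd_pow_conj ht hg' hg ha hY)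
        (by rwa [pow_succ, Module.End.mul_apply] at hZ), add_zero]

end TwistedCommutator

/-! ### `q`-binomial coefficients away from roots of unity. -/

section QBinomial

lemma qInt_ne_zero {z : ℂ} (h0 : z ≠ 0) (hz : ∀ n : ℕ, 0 < n → z ^ n ≠ 1) {m : ℕ} (hm : 0 < m) :
    qInt z m ≠ 0 := by
  have key : ∀ n : ℕ, 0 < n → z ^ n - (z⁻¹) ^ n ≠ 0 := by
    intro n hn h
    apply hz (n + n) (by omega)
    rw [sub_eq_zero] at h
    rw [pow_add]
    nth_rw 2 [h]
    rw [← mul_pow, mul_inv_cancel₀ h0, one_pow]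
  have h1 := key 1 one_pos
  simp only [pow_one] at h1
  exact div_ne_zero (key m hm) h1

lemma qFactorial_ne_zero {z : ℂ} (h0 : z ≠ 0) (hz : ∀ n : ℕ, 0 < n → z ^ n ≠ 1) (m : ℕ) :
    qFactorial z m ≠ 0 :=
  Finset.prod_ne_zero_iff.mpr fun _ _ => qInt_ne_zero h0 hz (Nat.succ_pos _)

lemma qFactorial_succ (z : ℂ) (m : ℕ) :
    qFactorial z (m + 1) = qFactorial z m * qInt z (m + 1) :=
  Finset.prod_range_succ _ _

lemma qBinom_self {z : ℂ} (h0 : z ≠ 0) (hz : ∀ n : ℕ, 0 < n → z ^ n ≠ 1) (n : ℕ) :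
    qBinom z n n = 1 := by
  have := qFactorial_ne_zero h0 hz n
  have h1 : qFactorial z 0 = 1 := by simp [qFactorial]
  rw [qBinom, Nat.sub_self, h1, mul_one, div_self this]

lemma qBinom_zero_right {z : ℂ} (h0 : z ≠ 0) (hz : ∀ n : ℕ, 0 < n → z ^ n ≠ 1) (n : ℕ) :
    qBinom z n 0 = 1 := by
  have := qFactorial_ne_zero h0 hz n
  have h1 : qFactorial z 0 = 1 := by simp [qFactorial]
  rw [qBinom, Nat.sub_zero, h1, one_mul, div_self this]

/-- The Pascal rule for `q`-binomial coefficients. -/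
lemma qBinom_succ_succ {z : ℂ} (h0 : z ≠ 0) (hz : ∀ n : ℕ, 0 < n → z ^ n ≠ 1) {n k : ℕ}
    (hk : k < n) :
    qBinom z (n + 1) (k + 1) =
      (z⁻¹) ^ (n - k) * qBinom z n k + z ^ (k + 1) * qBinom z n (k + 1) := by
  obtain ⟨m, rfl⟩ := Nat.exists_eq_add_of_lt hk
  have e1 : k + m + 1 + 1 - (k + 1) = m + 1 := by omega
  have e2 : k + m + 1 - k = m + 1 := by omega
  have e3 : k + m + 1 - (k + 1) = m := by omega
  simp only [qBinom, e1, e2, e3]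
  rw [qFactorial_succ z (k + m + 1), qFactorial_succ z k, qFactorial_succ z m]
  have a1 := qFactorial_ne_zero h0 hz k
  have a2 := qFactorial_ne_zero h0 hz m
  have a3 := qInt_ne_zero h0 hz (Nat.succ_pos k)
  have a4 := qInt_ne_zero h0 hz (Nat.succ_pos m)
  have key : qInt z (k + m + 1 + 1) =
      (z⁻¹) ^ (m + 1) * qInt z (k + 1) + z ^ (k + 1) * qInt z (m + 1) := by
    simp only [qInt]
    rw [mul_div_assoc', mul_div_assoc', ← add_div]
    congr 1
    have : k + m + 1 + 1 = (k + 1) + (m + 1) := by omega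
    rw [this, pow_add, pow_add]
    ring
  rw [key]
  field_simp

end QBinomial

/-! ### Expansion of powers of a twisted commutator. -/

section Serre

variable {A : Type*} [Ring A] [Algebra ℂ A]

/-- Powers of a twisted commutator expand with `q`-binomial coefficients. -/
lemma twistedAd_pow_apply {z : ℂ} (h0 : z ≠ 0) (hz : ∀ n : ℕ, 0 < n → z ^ n ≠ 1)
    {g g' a Y : A} {t : ℂ} (hg : g * g' = 1)
    (ha : g * a = (z ^ 2) • (a * g)) (hY : g * Y = t • (Y * g)) (n : ℕ) :
    (twistedAd g g' a ^ n) Y = ∑ k ∈ Finset.range (n + 1),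
      ((-t) ^ (n - k) * z ^ ((n - k) * (n - 1)) * qBinom z n k) • (a ^ k * Y * a ^ (n - k)) := by
  have hpow : ∀ k, g * a ^ k = (z ^ 2) ^ k • (a ^ k * g) := by
    intro k
    induction k with
    | zero => simp
    | succ k ih =>
      rw [pow_succ a, ← mul_assoc, ih, smul_mul_assoc, mul_assoc, ha, mul_smul_comm, smul_smul,
        ← pow_succ, mul_assoc]
  have hterm : ∀ k m : ℕ, twistedAd g g' a (a ^ k * Y * a ^ m) =
      a ^ (k + 1) * Y * a ^ m - (z ^ (2 * (k + m)) * t) • (a ^ k * Y * a ^ (m + 1)) := by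
    intro k m
    have : g * (a ^ k * Y * a ^ m) = (z ^ (2 * (k + m)) * t) • (a ^ k * Y * a ^ m * g) := by
      rw [← mul_assoc, ← mul_assoc, hpow, smul_mul_assoc, smul_mul_assoc, mul_assoc (a ^ k), hY,
        mul_smul_comm, smul_mul_assoc, mul_assoc, mul_assoc Y, hpow, mul_smul_comm, mul_smul_comm,
        smul_smul, smul_smul]
      congr 1
      · ring
      · simp only [mul_assoc]
    rw [twistedAd_of_conj hg this]
    rw [pow_succ' a k, pow_succ a m]
    simp only [mul_assoc]
  induction n with
  | zero => simp [qBinom_self h0 hz]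
  | succ n ih =>
    rw [pow_succ', Module.End.mul_apply, ih, map_sum]
    simp only [map_smul, hterm]
    simp only [smul_sub, Finset.sum_sub_distrib, smul_smul]
    conv_rhs => rw [Finset.sum_range_succ', Finset.sum_range_succ]
    conv_lhs =>
      congr
      · rw [Finset.sum_range_succ]
      · rw [Finset.sum_range_succ']
    -- The inner coefficients agree by the Pascal rule; the two boundary terms of the sum are split
    -- off and treated separately.
    have hmid : ∀ k ∈ Finset.range n,
        ((-t) ^ (n + 1 - (k + 1)) * z ^ ((n + 1 - (k + 1)) * (n + 1 - 1)) *
            qBinom z (n + 1) (k + 1)) • (a ^ (k + 1) * Y * a ^ (n + 1 - (k + 1))) =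
          ((-t) ^ (n - k) * z ^ ((n - k) * (n - 1)) * qBinom z n k) •
              (a ^ (k + 1) * Y * a ^ (n - k)) -
            ((-t) ^ (n - (k + 1)) * z ^ ((n - (k + 1)) * (n - 1)) * qBinom z n (k + 1) *
                (z ^ (2 * (k + 1 + (n - (k + 1)))) * t)) •
              (a ^ (k + 1) * Y * a ^ (n - (k + 1) + 1)) := by
      intro k hk
      rw [Finset.mem_range] at hk
      obtain ⟨m, rfl⟩ := Nat.exists_eq_add_of_lt hk
      have e1 : k + m + 1 + 1 - (k + 1) = m + 1 := by omega
      have e2 : k + m + 1 - k = m + 1 := by omega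
      have e3 : k + m + 1 - (k + 1) = m := by omega
      have e4 : k + m + 1 + 1 - 1 = k + m + 1 := by omega
      have e5 : k + m + 1 - 1 = k + m := by omega
      rw [qBinom_succ_succ h0 hz hk]
      simp only [e1, e2, e3, e4, e5]
      rw [← sub_smul]
      congr 1
      have h1 : z ^ ((m + 1) * (k + m + 1)) * (z⁻¹) ^ (m + 1) = z ^ ((m + 1) * (k + m)) := by
        rw [show (m + 1) * (k + m + 1) = (m + 1) * (k + m) + (m + 1) by ring, pow_add, mul_assoc,
          ← mul_pow, mul_inv_cancel₀ h0, one_pow, mul_one]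
      have h2 : z ^ ((m + 1) * (k + m + 1)) * z ^ (k + 1) =
          z ^ (m * (k + m)) * z ^ (2 * (k + 1 + m)) := by
        rw [← pow_add, ← pow_add]
        congr 1
        ring
      linear_combination ((-t) ^ (m + 1) * qBinom z (k + m + 1) k) * h1 +
        ((-t) ^ (m + 1) * qBinom z (k + m + 1) (k + 1)) * h2
    rw [Finset.sum_congr rfl hmid, Finset.sum_sub_distrib]
    have hlast : ((-t) ^ (n + 1 - 0) * z ^ ((n + 1 - 0) * (n + 1 - 1)) * qBinom z (n + 1) 0) •
        (a ^ 0 * Y * a ^ (n + 1 - 0)) =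
        -(((-t) ^ (n - 0) * z ^ ((n - 0) * (n - 1)) * qBinom z n 0 *
          (z ^ (2 * (0 + (n - 0))) * t)) • (a ^ 0 * Y * a ^ (n - 0 + 1))) := by
      rw [← neg_smul]
      simp only [Nat.sub_zero, qBinom_zero_right h0 hz, zero_add, Nat.add_sub_cancel]
      congr 1
      have : z ^ ((n + 1) * n) = z ^ (n * (n - 1)) * z ^ (2 * n) := by
        rw [← pow_add]
        congr 1
        rcases n with _ | n
        · rfl
        · rw [Nat.add_sub_cancel]; ring
      rw [this]
      ring
    rw [hlast]
    simp only [Nat.sub_self, qBinom_self h0 hz, pow_zero, zero_mul]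
    abel

end Serre

/-! ### Strings for quantum `𝔰𝔩₂`. -/

section Strings

lemma one_sub_zpow_ne_zero {z : ℂ} (hz : ∀ n : ℕ, 0 < n → z ^ n ≠ 1) {n : ℤ} (hn : n ≠ 0) :
    1 - z ^ n ≠ 0 := by
  rw [sub_ne_zero, ne_comm]
  obtain ⟨m, rfl | rfl⟩ := n.eq_nat_or_neg
  · rw [zpow_natCast]
    exact hz m (by omega)
  · rw [zpow_neg, zpow_natCast, ne_eq, inv_eq_one]
    exact hz m (by omega)

variable {U : Type*} [AddCommGroup U] [Module ℂ U]

/-- A string of weight spaces for a pair of operators satisfying the relations of quantum `𝔰𝔩₂`,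
with `E` lowering and `F` raising the index; on the `k`-th space the Cartan element acts with
exponent `b + 2k`. -/
structure IsString (z : ℂ) (E F : Module.End ℂ U) (N : ℤ → Submodule ℂ U) (b : ℤ) : Prop where
  ne_zero : z ≠ 0
  pow_ne_one (n : ℕ) (hn : 0 < n) : z ^ n ≠ 1
  mapE {k : ℤ} {y : U} (hy : y ∈ N k) : E y ∈ N (k - 1)
  mapF {k : ℤ} {y : U} (hy : y ∈ N k) : F y ∈ N (k + 1)
  rel {k : ℤ} {y : U} (hy : y ∈ N k) :
    z ^ (-2 : ℤ) • E (F y) - F (E y) = ((1 - z ^ (2 * (b + 2 * k))) * (z - z⁻¹)⁻¹) • y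
  eq_zero {k : ℤ} (hk : k < 0) {y : U} (hy : y ∈ N k) : y = 0
  nilpotent {k : ℤ} {y : U} (hy : y ∈ N k) : ∃ n : ℕ, (F ^ n) y = 0

namespace IsString

variable {z : ℂ} {E F : Module.End ℂ U} {N : ℤ → Submodule ℂ U} {b : ℤ} (h : IsString z E F N b)
include h

lemma sub_inv_ne_zero : z - z⁻¹ ≠ 0 := by
  intro h1
  apply h.pow_ne_one 2 two_pos
  rw [sub_eq_zero] at h1
  rw [pow_two]
  nth_rw 2 [h1]
  exact mul_inv_cancel₀ h.ne_zero

lemma powF_mem {k : ℤ} {y : U} (hy : y ∈ N k) (n : ℕ) : (F ^ n) y ∈ N (k + n) := by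
  induction n with
  | zero => simpa
  | succ n ih =>
    rw [pow_succ', Module.End.mul_apply]
    simpa [add_assoc] using h.mapF ih

lemma powE_mem {k : ℤ} {y : U} (hy : y ∈ N k) (n : ℕ) : (E ^ n) y ∈ N (k - n) := by
  induction n with
  | zero => simpa
  | succ n ih =>
    rw [pow_succ', Module.End.mul_apply]
    simpa [sub_sub] using h.mapE ih

/-- The `𝔰𝔩₂` computation in closed form. Since `z` is not a root of unity, the scalar vanishes only
if `n + b + 2k = 0`. -/
lemma E_powF {k : ℤ} {y : U} (hy : y ∈ N k) (hE : E y = 0) (n : ℕ) :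
    E ((F ^ (n + 1)) y) = (z ^ (2 : ℤ) * ((z - z⁻¹)⁻¹ * (1 - z ^ (2 : ℤ))⁻¹) *
      (1 - z ^ (2 * (n + 1) : ℤ)) * (1 - z ^ (2 * (n + b + 2 * k) : ℤ))) • (F ^ n) y := by
  have h0 := h.ne_zero
  have h2 : z ^ (2 : ℤ) ≠ 0 := zpow_ne_zero _ h0
  have h3 : 1 - z ^ (2 : ℤ) ≠ 0 := one_sub_zpow_ne_zero h.pow_ne_one (by norm_num)
  have step : ∀ n : ℕ, E ((F ^ (n + 1)) y) = z ^ (2 : ℤ) • (F (E ((F ^ n) y)) +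
      ((1 - z ^ (2 * (b + 2 * (k + n)))) * (z - z⁻¹)⁻¹) • (F ^ n) y) := by
    intro n
    have := h.rel (h.powF_mem hy n)
    rw [sub_eq_iff_eq_add] at this
    rw [add_comm (F _), ← this, smul_smul, ← zpow_add₀ h0, pow_succ', Module.End.mul_apply]
    simp
  induction n with
  | zero =>
    rw [step]
    simp only [pow_zero, Module.End.one_apply, hE, map_zero, zero_add, Nat.cast_zero, add_zero,
      mul_one, smul_smul]
    congr 1
    linear_combination (-(z ^ (2 : ℤ) * (1 - z ^ (2 * (b + 2 * k))) * (z - z⁻¹)⁻¹)) *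
      inv_mul_cancel₀ h3
  | succ n ih =>
    rw [step, ih, map_smul, ← Module.End.mul_apply, ← pow_succ', ← add_smul, smul_smul]
    congr 1
    push_cast
    have e1 : z ^ (2 * (n + 1 + 1) : ℤ) = z ^ (2 * (n + 1) : ℤ) * z ^ (2 : ℤ) := by
      rw [← zpow_add₀ h0]; ring_nf
    have e2 : z ^ (2 * (n + 1 + b + 2 * k) : ℤ) = z ^ (2 * (n + b + 2 * k) : ℤ) * z ^ (2 : ℤ) := by
      rw [← zpow_add₀ h0]; ring_nf
    have e3 : z ^ (2 * (b + 2 * (k + (n + 1))) : ℤ) =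
        z ^ (2 * (n + 1) : ℤ) * z ^ (2 * (n + b + 2 * k) : ℤ) * z ^ (2 : ℤ) := by
      rw [← zpow_add₀ h0, ← zpow_add₀ h0]; ring_nf
    rw [e1, e2, e3]
    generalize z ^ (2 * (n + 1) : ℤ) = u
    generalize z ^ (2 * (n + b + 2 * k) : ℤ) = w
    generalize z ^ (2 : ℤ) = t at *
    field_simp
    ring

/-- The mirror computation for a vector killed by `F`; the scalar vanishes only if `n = b + 2k`. -/
lemma F_powE {k : ℤ} {y : U} (hy : y ∈ N k) (hF : F y = 0) (n : ℕ) :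
    F ((E ^ (n + 1)) y) = (-((z - z⁻¹)⁻¹ * (1 - z ^ (-2 : ℤ))⁻¹) *
      (1 - z ^ (-2 * (n + 1) : ℤ)) * (1 - z ^ (2 * (b + 2 * k - n) : ℤ))) • (E ^ n) y := by
  have h0 := h.ne_zero
  have h3 : 1 - z ^ (-2 : ℤ) ≠ 0 := one_sub_zpow_ne_zero h.pow_ne_one (by norm_num)
  have step : ∀ n : ℕ, F ((E ^ (n + 1)) y) = z ^ (-2 : ℤ) • E (F ((E ^ n) y)) -
      ((1 - z ^ (2 * (b + 2 * (k - n)))) * (z - z⁻¹)⁻¹) • (E ^ n) y := by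
    intro n
    have := h.rel (h.powE_mem hy n)
    rw [← this, pow_succ', Module.End.mul_apply]
    abel
  induction n with
  | zero =>
    rw [step]
    simp only [pow_zero, Module.End.one_apply, hF, map_zero, zero_sub, Nat.cast_zero, sub_zero,
      smul_zero, zero_add, mul_one, ← neg_smul]
    congr 1
    field_simp
  | succ n ih =>
    rw [step, ih, map_smul, ← Module.End.mul_apply, ← pow_succ', smul_smul, ← sub_smul]
    congr 1
    push_cast
    have e1 : z ^ (-2 * (n + 1 + 1) : ℤ) = z ^ (-2 * (n + 1) : ℤ) * z ^ (-2 : ℤ) := by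
      rw [← zpow_add₀ h0]; ring_nf
    have e2 : z ^ (2 * (b + 2 * k - (n + 1)) : ℤ) =
        z ^ (2 * (b + 2 * k - n) : ℤ) * z ^ (-2 : ℤ) := by
      rw [← zpow_add₀ h0]; ring_nf
    have e3 : z ^ (2 * (b + 2 * (k - (n + 1))) : ℤ) =
        z ^ (-2 * (n + 1) : ℤ) * z ^ (2 * (b + 2 * k - n) : ℤ) * z ^ (-2 : ℤ) := by
      rw [← zpow_add₀ h0, ← zpow_add₀ h0]; ring_nf
    rw [e1, e2, e3]
    generalize z ^ (-2 * (n + 1) : ℤ) = u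
    generalize z ^ (2 * (b + 2 * k - n) : ℤ) = w
    generalize z ^ (-2 : ℤ) = t at *
    field_simp
    ring

lemma exists_E_powF {k : ℤ} {y : U} (hy : y ∈ N k) (hE : E y = 0) {n : ℕ}
    (hn : n + b + 2 * k ≠ 0) : ∃ c : ℂ, c ≠ 0 ∧ E ((F ^ (n + 1)) y) = c • (F ^ n) y := by
  refine ⟨_, ?_, h.E_powF hy hE n⟩
  have h3 : ∀ m : ℤ, m ≠ 0 → 1 - z ^ m ≠ 0 := fun m hm => one_sub_zpow_ne_zero h.pow_ne_one hm
  exact mul_ne_zero (mul_ne_zero (mul_ne_zero (zpow_ne_zero _ h.ne_zero)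
    (mul_ne_zero (inv_ne_zero h.sub_inv_ne_zero) (inv_ne_zero (h3 _ (by norm_num)))))
    (h3 _ (by omega))) (h3 _ (by omega))

lemma exists_F_powE {k : ℤ} {y : U} (hy : y ∈ N k) (hF : F y = 0) {n : ℕ}
    (hn : b + 2 * k - n ≠ 0) : ∃ c : ℂ, c ≠ 0 ∧ F ((E ^ (n + 1)) y) = c • (E ^ n) y := by
  refine ⟨_, ?_, h.F_powE hy hF n⟩
  have h3 : ∀ m : ℤ, m ≠ 0 → 1 - z ^ m ≠ 0 := fun m hm => one_sub_zpow_ne_zero h.pow_ne_one hm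
  exact mul_ne_zero (mul_ne_zero (neg_ne_zero.mpr
    (mul_ne_zero (inv_ne_zero h.sub_inv_ne_zero) (inv_ne_zero (h3 _ (by norm_num)))))
    (h3 _ (by omega))) (h3 _ (by omega))

lemma powF_ne_zero {k : ℤ} {y : U} (hy : y ∈ N k) (hE : E y = 0) (h0 : y ≠ 0) {n : ℕ}
    (hn : ∀ m : ℕ, m < n → m + b + 2 * k ≠ 0) : (F ^ n) y ≠ 0 := by
  induction n with
  | zero => simpa
  | succ n ih =>
    obtain ⟨c, hc, hc'⟩ := h.exists_E_powF hy hE (hn n (by omega))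
    intro hz
    rw [hz, map_zero, eq_comm, smul_eq_zero] at hc'
    exact hc'.elim hc (ih fun m hm => hn m (by omega))

lemma powE_ne_zero {k : ℤ} {y : U} (hy : y ∈ N k) (hF : F y = 0) (h0 : y ≠ 0) {n : ℕ}
    (hn : n ≤ b + 2 * k) : (E ^ n) y ≠ 0 := by
  induction n with
  | zero => simpa
  | succ n ih =>
    obtain ⟨c, hc, hc'⟩ := h.exists_F_powE hy hF (n := n) (by push_cast at hn; omega)
    intro hz
    rw [hz, map_zero, eq_comm, smul_eq_zero] at hc'
    exact hc'.elim hc (ih (by push_cast at hn; omega))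

/-- A vector killed by `E` whose Cartan exponent is positive vanishes. -/
lemma eq_zero_of_E_eq_zero {k : ℤ} {y : U} (hy : y ∈ N k) (hE : E y = 0) (hk : 0 < b + 2 * k) :
    y = 0 := by
  by_contra h0
  obtain ⟨n, hn⟩ := h.nilpotent hy
  -- All `m + b + 2k` are positive, so no power of `F` kills `y`, against nilpotency.
  exact h.powF_ne_zero hy hE h0 (fun m _ => by omega) hn

/-- A string starting in degree `0` ends in degree `-b`. -/
lemma eq_zero_of_neg_lt {k : ℤ} (hk : -b < k) {y : U} (hy : y ∈ N k) : y = 0 := by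
  by_contra h0
  classical
  have hex := h.nilpotent hy
  have hspec := Nat.find_spec hex
  have hmin := fun m => Nat.find_min hex (m := m)
  generalize Nat.find hex = n at hspec hmin
  obtain _ | n := n
  · exact h0 (by simpa using hspec)
  have hw : (F ^ n) y ≠ 0 := hmin n (by omega)
  have hFw : F ((F ^ n) y) = 0 := by rwa [pow_succ', Module.End.mul_apply] at hspec
  have hmem := h.powF_mem hy n
  -- The vector `(F ^ n) y` is the last non-zero one, with exponent `e = b + 2(k + n)`. If `e ≥ 0`,
  -- its image under `E ^ e` is non-zero but has degree `-(b + k + n) < 0`. If `e < 0`, then `k + n`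
  -- is already negative because `k > -b`.
  by_cases hpos : 0 ≤ b + 2 * (k + n)
  · refine h.powE_ne_zero hmem hFw hw (n := (b + 2 * (k + n)).toNat) (by omega) ?_
    exact h.eq_zero (by omega) (h.powE_mem hmem _)
  · exact hw (h.eq_zero (by omega) hmem)

/-- If the degree `n` part of a string is a line, then it is spanned by the `n`-th image of any
non-zero vector in degree `0`. -/
lemma eq_span_powF {v : U}
    (hv : v ∈ N 0) (hv0 : v ≠ 0) {n : ℕ} (hn : (n : ℤ) ≤ -b)
    (hN : ∃ w, w ≠ 0 ∧ N n = Submodule.span ℂ {w}) :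
    (F ^ n) v ≠ 0 ∧ N n = Submodule.span ℂ {(F ^ n) v} := by
  have hE : E v = 0 := h.eq_zero (by norm_num) (h.mapE hv)
  have hne : (F ^ n) v ≠ 0 := h.powF_ne_zero hv hE hv0 fun m hm => by omega
  refine ⟨hne, ?_⟩
  obtain ⟨w, hw, hN⟩ := hN
  have hmem := h.powF_mem hv n
  rw [zero_add, hN, Submodule.mem_span_singleton] at hmem
  obtain ⟨c, hc⟩ := hmem
  have hc0 : c ≠ 0 := by
    rintro rfl
    exact hne (by rw [← hc, zero_smul])
  rw [hN, ← hc, Submodule.span_singleton_smul_eq (IsUnit.mk0 c hc0)]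

end IsString

end Strings

/-! ### Adjoint actions of `x̃⁻_{i,0}` and `x⁺_{i,0}` on the loop algebra. -/

section AdjointAction

/-- The properties of a symmetrized Cartan matrix and of a generic parameter `q` on which
computations in the quantum loop algebra rely. -/
structure IsGenericDatum {I : Type*} (C : Matrix I I ℤ) (d : I → ℕ) (q : ℂ) : Prop where
  ne_zero : q ≠ 0
  pow_ne_one (n : ℕ) (hn : 0 < n) : q ^ n ≠ 1
  pos (i : I) : 0 < d i
  symm (i j : I) : (d i : ℤ) * C i j = d j * C j i
  diag (i : I) : C i i = 2
  nonpos (i j : I) (hij : i ≠ j) : C i j ≤ 0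

namespace IsGenericDatum

variable {I : Type*} {C : Matrix I I ℤ} {d : I → ℕ} {q : ℂ} (h : IsGenericDatum C d q)
include h

lemma qi_ne_zero (i : I) : q ^ d i ≠ 0 := pow_ne_zero _ h.ne_zero

lemma qi_pow_ne_one (i : I) (n : ℕ) (hn : 0 < n) : (q ^ d i) ^ n ≠ 1 := by
  rw [← pow_mul]
  exact h.pow_ne_one _ (Nat.mul_pos (h.pos i) hn)

lemma qi_sub_inv_ne_zero (i : I) : q ^ d i - (q ^ d i)⁻¹ ≠ 0 := by
  intro h1
  apply h.qi_pow_ne_one i 2 two_pos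
  rw [sub_eq_zero] at h1
  rw [pow_two]
  nth_rw 2 [h1]
  exact mul_inv_cancel₀ (h.qi_ne_zero i)

lemma qi_zpow_sub_ne_zero (i : I) {n : ℤ} (hn : n ≠ 0) :
    (q ^ d i) ^ n - (q ^ d i) ^ (-n) ≠ 0 := by
  have h1 := one_sub_zpow_ne_zero (h.qi_pow_ne_one i) (n := 2 * n) (by omega)
  have h2 : (q ^ d i) ^ n - (q ^ d i) ^ (-n) = -((q ^ d i) ^ (-n) * (1 - (q ^ d i) ^ (2 * n))) := by
    rw [mul_sub, ← zpow_add₀ (h.qi_ne_zero i)]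
    ring_nf
  rw [h2]
  exact neg_ne_zero.mpr (mul_ne_zero (zpow_ne_zero _ (h.qi_ne_zero i)) h1)

lemma qi_zpow_comm (i j : I) (n : ℤ) : (q ^ d i) ^ (n * C i j) = (q ^ d j) ^ (n * C j i) := by
  rw [← zpow_natCast, ← zpow_natCast, ← zpow_mul, ← zpow_mul]
  congr 1
  linear_combination n * h.symm i j

end IsGenericDatum

variable {I : Type*} (C : Matrix I I ℤ) (d : I → ℕ) (q : ℂ)

/-- The adjoint action of `x̃⁻_{i,0}`. -/
def adF (i : I) : Module.End ℂ (LoopAlgebra C d q) :=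
  twistedAd (kInv C d q i) (k C d q i) (xTildeMinus C d q i 0)

/-- The adjoint action of `x⁺_{i,0}`. -/
def adE (i : I) : Module.End ℂ (LoopAlgebra C d q) :=
  twistedAd (kInv C d q i) (k C d q i) (xPlus C d q i 0)

variable {C d q}

lemma adE_adF_of_ne (h : IsGenericDatum C d q) {i j : I} (hij : i ≠ j) (Y : LoopAlgebra C d q) :
    (q ^ d i) ^ (-C i j) • adE C d q i (adF C d q j Y) = adF C d q j (adE C d q i Y) := by
  rw [← sub_eq_zero, adE, adF, twistedAd_comm (D := 0) (zpow_ne_zero _ (h.qi_ne_zero i))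
    (k_mul_kInv C d q i) (kInv_mul_k C d q i) (k_mul_kInv C d q j) (kInv_mul_k C d q j)
    (kInv_comm C d q i j)]
  · simp
  · rw [kInv_xTildeMinus, zpow_neg, inv_inv]
  · rw [kInv_xPlus]
    have := h.qi_zpow_comm i j (-1)
    simp only [neg_one_mul] at this
    rw [this]
  · rw [xPlus_xTildeMinus_of_ne C d q hij, sub_self]

/-- Here `D` is a multiple of `1 - κ_i²`, which acts on an element of weight exponent `n` by the
corresponding multiple of `1 - q_i^{2n}`. This is the quantum `𝔰𝔩₂` relation required in `IsString`.
-/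
lemma adE_adF_self (h : IsGenericDatum C d q) {i : I} {Y : LoopAlgebra C d q} {n : ℤ}
    (hY : kInv C d q i * Y = (q ^ d i) ^ n • (Y * kInv C d q i)) :
    (q ^ d i) ^ (-2 : ℤ) • adE C d q i (adF C d q i Y) - adF C d q i (adE C d q i Y) =
      ((1 - (q ^ d i) ^ (2 * n)) * (q ^ d i - (q ^ d i)⁻¹)⁻¹) • Y := by
  have hz := h.qi_ne_zero i
  have := xPlus_xTildeMinus_zero C d q i
  rw [h.diag] at this
  rw [adE, adF, twistedAd_comm (zpow_ne_zero _ hz)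
    (k_mul_kInv C d q i) (kInv_mul_k C d q i) (k_mul_kInv C d q i) (kInv_mul_k C d q i)
    rfl _ _ this]
  · have h1 : kInv C d q i * kInv C d q i * Y =
        (q ^ d i) ^ (2 * n) • (Y * (kInv C d q i * kInv C d q i)) := by
      rw [mul_assoc, hY, mul_smul_comm, ← mul_assoc, hY, smul_mul_assoc, smul_smul, ← zpow_add₀ hz,
        two_mul, mul_assoc]
    have h2 : kInv C d q i * kInv C d q i * (k C d q i * k C d q i) = 1 := by
      rw [mul_assoc, ← mul_assoc _ (k C d q i), kInv_mul_k, one_mul, kInv_mul_k]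
    have h3 (Z : LoopAlgebra C d q) :
        kInv C d q i * kInv C d q i * (k C d q i * k C d q i * Z) = Z := by
      rw [← mul_assoc, h2, one_mul]
    rw [h1, smul_mul_assoc _ (Y * _), mul_assoc Y, h3]
    simp only [smul_mul_assoc, mul_smul_comm, sub_mul, mul_sub, one_mul, mul_one, pow_two, h1]
    module
  · rw [kInv_xTildeMinus, h.diag]
    simp
  · rw [kInv_xPlus, h.diag]

lemma adE_xTildeMinus_of_ne (h : IsGenericDatum C d q) {i j : I} (hij : i ≠ j) :
    adE C d q i (xTildeMinus C d q j 1) = 0 := by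
  rw [adE, twistedAd_of_conj (kInv_mul_k C d q i) (kInv_xTildeMinus C d q i j 1),
    ← xPlus_xTildeMinus_of_ne C d q hij, smul_smul, ← zpow_add₀ (h.qi_ne_zero i)]
  simp

lemma adE_xTildeMinus_self (h : IsGenericDatum C d q) (i : I) :
    adE C d q i (xTildeMinus C d q i 1) =
      ((q ^ d i) ^ (2 : ℤ) * (q ^ d i - (q ^ d i)⁻¹)⁻¹) • phiTilde C d q i 1 := by
  have h1 := xPlus_xTildeMinus_of_pos C d q i 0 1 (by norm_num)
  rw [h.diag] at h1
  rw [adE, twistedAd_of_conj (kInv_mul_k C d q i) (kInv_xTildeMinus C d q i i 1), h.diag, mul_smul,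
    show phiTilde C d q i 1 = phiTilde C d q i (0 + 1 : ℤ).toNat from rfl, ← h1, smul_sub,
    smul_smul, ← zpow_add₀ (h.qi_ne_zero i)]
  simp

lemma adF_xTildeMinus_self (h : IsGenericDatum C d q) (i : I) :
    adF C d q i (xTildeMinus C d q i 1) = 0 := by
  rw [adF, twistedAd_of_conj (kInv_mul_k C d q i) (kInv_xTildeMinus C d q i i 1), h.diag,
    xTildeMinus_self C d q i (h.diag i), smul_smul, ← zpow_add₀ (h.qi_ne_zero i)]
  simp

/-- Together with `adE_xTildeMinus_self` this links `x̃⁻_{i,1}` and `x̃⁻_{j,1}` through `φ̃⁺_{i,1}`;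
the coefficient is non-zero when `C i j ≠ 0`. -/
lemma adF_phiTilde (i j : I) :
    adF C d q j (phiTilde C d q i 1) =
      ((q ^ d i) ^ C i j - (q ^ d i) ^ (-C i j)) • xTildeMinus C d q j 1 := by
  have h1 := phiTilde_one_xTildeMinus C d q i j 0
  rw [adF, twistedAd_of_conj (t := 1) (kInv_mul_k C d q j)
    (by rw [kInv_phiTilde, one_smul]), one_smul, h1, zero_add]
  module

/-- The twisted commutator form of the Serre relations. -/
lemma adF_pow_xTildeMinus (h : IsGenericDatum C d q) {i j : I} (hij : i ≠ j) (r : ℤ) :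
    (adF C d q i ^ (1 - C i j).toNat) (xTildeMinus C d q j r) = 0 := by
  have hz := h.qi_ne_zero i
  have hC := h.nonpos i j hij
  set s := (1 - C i j).toNat with hs
  rw [adF, twistedAd_pow_apply hz (h.qi_pow_ne_one i) (kInv_mul_k C d q i) (Y := xTildeMinus C d q j r)
    (by rw [kInv_xTildeMinus, h.diag]; norm_cast) (kInv_xTildeMinus C d q i j r)]
  have key := mk_eq_of_rel C d q (.serre (-1) i j hij (fun _ => 0) r)
  rw [← hs] at key
  simp only [serreSum, List.ofFn_const, List.take_replicate, List.drop_replicate,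
    List.prod_replicate, Finset.sum_const, map_zero, map_nsmul, map_sum, map_smul, map_mul,
    map_pow] at key
  -- All loop indices equal `0`, so the permutations contribute the same term, and the non-zero
  -- factor `s!` cancels.
  rw [← Nat.cast_smul_eq_nsmul ℂ, smul_eq_zero_iff_right (by simp [Fintype.card_ne_zero])] at key
  have h2 : ∀ k ∈ Finset.range (s + 1),
      ((-(q ^ d i) ^ C i j) ^ (s - k) * (q ^ d i) ^ ((s - k) * (s - 1)) * qBinom (q ^ d i) s k) •
        (xTildeMinus C d q i 0 ^ k * xTildeMinus C d q j r * xTildeMinus C d q i 0 ^ (s - k)) =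
      ((-1) ^ s : ℂ) • (((-1) ^ k * qBinom (q ^ d i) s k) •
        (LoopAlgebra.mk C d q (fx (-1) i 0) ^ (min k s) * LoopAlgebra.mk C d q (fx (-1) j r) *
          LoopAlgebra.mk C d q (fx (-1) i 0) ^ (s - k))) := by
    intro k hk
    rw [Finset.mem_range] at hk
    have h3 : min k s = k := by omega
    rw [h3, smul_smul]
    simp only [xTildeMinus]
    congr 1
    -- With `t = q_i ^ C i j` and `s - 1 = -C i j` all powers of `q_i` cancel, so the expansion is
    -- the Serre sum up to the sign `(-1) ^ s`.
    have h4 : ((q ^ d i) ^ C i j) ^ (s - k) * (q ^ d i) ^ ((s - k) * (s - 1)) = 1 := by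
      rw [← zpow_natCast ((q ^ d i) ^ C i j), ← zpow_mul, ← zpow_natCast (q ^ d i) (_ * _),
        ← zpow_add₀ hz]
      have : C i j * ((s - k : ℕ) : ℤ) + (((s - k) * (s - 1) : ℕ) : ℤ) = 0 := by
        have : ((s - 1 : ℕ) : ℤ) = - C i j := by omega
        push_cast [this]
        ring
      rw [this, zpow_zero]
    have h5 : (-1 : ℂ) ^ (s - k) = (-1) ^ s * (-1) ^ k := by
      obtain ⟨m, hm⟩ := Nat.exists_eq_add_of_le (show k ≤ s by omega)
      rw [hm, Nat.add_sub_cancel_left, pow_add, mul_right_comm, ← pow_add, ← two_mul, pow_mul]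
      simp
    rw [neg_pow, h5]
    linear_combination ((-1) ^ s * (-1) ^ k * qBinom (q ^ d i) s k) * h4
  rw [Finset.sum_congr rfl h2, ← Finset.smul_sum, key, smul_zero]

end AdjointAction

/-! ### Spans of iterated brackets and the quantum `𝔰𝔩₂` actions on them. -/

section WordSpaces

variable {I : Type*} [DecidableEq I] {C : Matrix I I ℤ} {d : I → ℕ} {q : ℂ}

/-- The sum `α_{i₁} + ⋯ + α_{i_k} + α_j` in coordinates with respect to the simple roots. -/
def wordWeight : List I → I → (I → ℤ)
  | [], j => Pi.single j 1
  | i :: l, j => wordWeight l j + Pi.single i 1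

lemma wordWeight_nonneg (l : List I) (j : I) : 0 ≤ wordWeight l j := by
  induction l with
  | nil => simp [wordWeight]
  | cons i l ih => exact add_nonneg ih (by simp)

variable (C d q) in
/-- The span of the iterated `q`-commutators of weight `-β`. -/
def wordSpace (β : I → ℤ) : Submodule ℂ (LoopAlgebra C d q) :=
  Submodule.span ℂ {Y | ∃ l j, wordWeight l j = β ∧ iteratedBracket C d q l j = Y}

lemma iteratedBracket_mem_wordSpace (l : List I) (j : I) :
    iteratedBracket C d q l j ∈ wordSpace C d q (wordWeight l j) :=
  Submodule.subset_span ⟨l, j, rfl, rfl⟩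

variable [Fintype I]

/-- The pairing `⟨β, α_i^∨⟩` for `β = ∑ β_j α_j`. -/
def corootPairing (C : Matrix I I ℤ) (i : I) : (I → ℤ) →+ ℤ where
  toFun β := ∑ j, C i j * β j
  map_zero' := by simp
  map_add' := by simp [mul_add, Finset.sum_add_distrib]

@[simp] lemma corootPairing_single (i j : I) : corootPairing C i (Pi.single j 1) = C i j := by
  simp [corootPairing, Pi.single_apply]

lemma iteratedBracket_conj (h : IsGenericDatum C d q) (l : List I) (i j : I) :
    kInv C d q i * iteratedBracket C d q l j = (q ^ d i) ^ corootPairing C i (wordWeight l j) •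
      (iteratedBracket C d q l j * kInv C d q i) := by
  induction l with
  | nil => simpa [iteratedBracket, wordWeight] using kInv_xTildeMinus C d q i j 1
  | cons i' l ih =>
    have hz := h.qi_ne_zero i
    simp only [iteratedBracket, wordWeight, map_add, corootPairing_single, zpow_add₀ hz]
    have h1 : kInv C d q i * (xTildeMinus C d q i' 0 * iteratedBracket C d q l j) =
        ((q ^ d i) ^ corootPairing C i (wordWeight l j) * (q ^ d i) ^ C i i') •
          (xTildeMinus C d q i' 0 * iteratedBracket C d q l j * kInv C d q i) := by
      rw [← mul_assoc, kInv_xTildeMinus, smul_mul_assoc, mul_assoc, ih, mul_smul_comm, smul_smul,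
        mul_assoc, mul_comm ((q ^ d i) ^ C i i')]
    have h2 : kInv C d q i * (iteratedBracket C d q l j * xTildeMinus C d q i' 0) =
        ((q ^ d i) ^ corootPairing C i (wordWeight l j) * (q ^ d i) ^ C i i') •
          (iteratedBracket C d q l j * xTildeMinus C d q i' 0 * kInv C d q i) := by
      rw [← mul_assoc, ih, smul_mul_assoc, mul_assoc, kInv_xTildeMinus, mul_smul_comm, smul_smul,
        mul_assoc]
    rw [mul_sub, sub_mul, smul_sub, h1, mul_smul_comm, h2, smul_mul_assoc, smul_comm]

lemma sum_eq_corootPairing_wordWeight (l : List I) (i j : I) :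
    ((l ++ [j]).map fun s => (d i : ℤ) * C i s).sum =
      d i * corootPairing C i (wordWeight l j) := by
  induction l with
  | nil => simp [wordWeight]
  | cons i' l ih =>
    simp only [List.cons_append, List.map_cons, List.sum_cons, ih, wordWeight, map_add,
      corootPairing_single]
    ring

/-- The exponent `(α_i, β)` is `d_i ⟨β, α_i^∨⟩`, the scalar by which `κ_i` commutes past the inner
bracket, so the `q`-commutator is an adjoint action. -/
lemma iteratedBracket_cons (h : IsGenericDatum C d q) (l : List I) (i j : I) :
    iteratedBracket C d q (i :: l) j = adF C d q i (iteratedBracket C d q l j) := by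
  rw [adF, twistedAd_of_conj (kInv_mul_k C d q i) (iteratedBracket_conj h l i j), iteratedBracket,
    sum_eq_corootPairing_wordWeight, zpow_mul, zpow_natCast]

lemma wordSpace_conj (h : IsGenericDatum C d q) (i : I) {β : I → ℤ} {Y : LoopAlgebra C d q}
    (hY : Y ∈ wordSpace C d q β) :
    kInv C d q i * Y = (q ^ d i) ^ corootPairing C i β • (Y * kInv C d q i) := by
  induction hY using Submodule.span_induction with
  | mem Y hY =>
    obtain ⟨l, j, rfl, rfl⟩ := hY
    exact iteratedBracket_conj h l i j
  | zero => simp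
  | add Y Z _ _ hY hZ => rw [mul_add, hY, hZ, add_mul, smul_add]
  | smul c Y _ hY => rw [mul_smul_comm, hY, smul_mul_assoc, smul_comm]

lemma adF_mem_wordSpace (h : IsGenericDatum C d q) (i : I) {β : I → ℤ} {Y : LoopAlgebra C d q}
    (hY : Y ∈ wordSpace C d q β) : adF C d q i Y ∈ wordSpace C d q (β + Pi.single i 1) := by
  induction hY using Submodule.span_induction with
  | mem Y hY =>
    obtain ⟨l, j, rfl, rfl⟩ := hY
    rw [← iteratedBracket_cons h]
    exact iteratedBracket_mem_wordSpace (i :: l) j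
  | zero => simp
  | add Y Z _ _ hY hZ => rw [map_add]; exact add_mem hY hZ
  | smul c Y _ hY => rw [map_smul]; exact Submodule.smul_mem _ _ hY

lemma wordWeight_sum (l : List I) (j : I) : ∑ i, wordWeight l j i = l.length + 1 := by
  induction l with
  | nil => simp [wordWeight]
  | cons i l ih => simp [wordWeight, Finset.sum_add_distrib, ih]

lemma eq_nil_of_wordWeight_eq_single {l : List I} {i j : I}
    (h : wordWeight l j = Pi.single i 1) : l = [] ∧ j = i := by
  have h1 := wordWeight_sum l j
  rw [h] at h1
  have h2 : l = [] := by simpa using h1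
  subst h2
  refine ⟨rfl, ?_⟩
  by_contra hij
  have := congrFun h i
  simp [wordWeight, Ne.symm hij] at this

/-- `adE` is moved past the outermost `adF`, reducing to a shorter word. The excluded case is
`x̃⁻_{i,1}` itself, which is sent to a multiple of `φ̃⁺_{i,1}` rather than to a bracket. -/
lemma adE_iteratedBracket_mem (h : IsGenericDatum C d q) (i : I) (l : List I) (j : I)
    (hl : wordWeight l j ≠ Pi.single i 1) :
    adE C d q i (iteratedBracket C d q l j) ∈ wordSpace C d q (wordWeight l j - Pi.single i 1) := by
  induction l with
  | nil =>
    have hij : i ≠ j := by rintro rfl; simp [wordWeight] at hl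
    simp [iteratedBracket, adE_xTildeMinus_of_ne h hij]
  | cons i' l ih =>
    have hrec : adF C d q i' (adE C d q i (iteratedBracket C d q l j)) ∈
        wordSpace C d q (wordWeight (i' :: l) j - Pi.single i 1) := by
      by_cases hw : wordWeight l j = Pi.single i 1
      -- The excluded case occurs for the inner word, but `adF` brings `φ̃⁺_{i,1}` back to a
      -- multiple of `x̃⁻_{i',1}`.
      · obtain ⟨rfl, rfl⟩ := eq_nil_of_wordWeight_eq_single hw
        rw [iteratedBracket, adE_xTildeMinus_self h, map_smul, adF_phiTilde]
        refine Submodule.smul_mem _ _ (Submodule.smul_mem _ _ ?_)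
        have := iteratedBracket_mem_wordSpace (C := C) (d := d) (q := q) [] i'
        simpa [iteratedBracket, wordWeight] using this
      · have := adF_mem_wordSpace h i' (ih hw)
        rwa [sub_add_eq_add_sub] at this
    rw [iteratedBracket_cons h]
    by_cases hii : i = i'
    · subst hii
      have h1 := adE_adF_self h (iteratedBracket_conj h l i j)
      have hz : (q ^ d i) ^ (-2 : ℤ) ≠ 0 := zpow_ne_zero _ (h.qi_ne_zero i)
      rw [sub_eq_iff_eq_add] at h1
      rw [← Submodule.smul_mem_iff _ hz, h1]
      refine add_mem (Submodule.smul_mem _ _ ?_) hrec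
      simpa [wordWeight] using iteratedBracket_mem_wordSpace l j
    · have hz : (q ^ d i) ^ (-C i i') ≠ 0 := zpow_ne_zero _ (h.qi_ne_zero i)
      rw [← Submodule.smul_mem_iff _ hz, adE_adF_of_ne h hii]
      exact hrec

lemma adE_mem_wordSpace (h : IsGenericDatum C d q) (i : I) {β : I → ℤ} (hβ : β ≠ Pi.single i 1)
    {Y : LoopAlgebra C d q} (hY : Y ∈ wordSpace C d q β) :
    adE C d q i Y ∈ wordSpace C d q (β - Pi.single i 1) := by
  induction hY using Submodule.span_induction with
  | mem Y hY =>
    obtain ⟨l, j, rfl, rfl⟩ := hY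
    exact adE_iteratedBracket_mem h i l j hβ
  | zero => simp
  | add Y Z _ _ hY hZ => rw [map_add]; exact add_mem hY hZ
  | smul c Y _ hY => rw [map_smul]; exact Submodule.smul_mem _ _ hY

/-- For `i' ≠ i` the bracket is a combination of products with `x̃⁻_{i',0}`, which is nilpotent
under `adF` by the Serre relation, and nilpotency passes to products. For `i' = i` the bracket is
itself an image of `adF`. -/
lemma adF_nilpotent_iteratedBracket (h : IsGenericDatum C d q) (i : I) (l : List I) (j : I) :
    ∃ n : ℕ, (adF C d q i ^ n) (iteratedBracket C d q l j) = 0 := by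
  have hone : ∀ j r, i ≠ j → ∃ n : ℕ, (adF C d q i ^ n) (xTildeMinus C d q j r) = 0 :=
    fun j r hij => ⟨_, adF_pow_xTildeMinus h hij r⟩
  have hprod : ∀ Y Z, (∃ n : ℕ, (adF C d q i ^ n) Y = 0) → (∃ n : ℕ, (adF C d q i ^ n) Z = 0) →
      ∃ n : ℕ, (adF C d q i ^ n) (Y * Z) = 0 := by
    rintro Y Z ⟨n, hn⟩ ⟨m, hm⟩
    exact ⟨n + m, twistedAd_pow_mul (zpow_ne_zero _ (h.qi_ne_zero i)) (k_mul_kInv C d q i)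
      (kInv_mul_k C d q i) (kInv_xTildeMinus C d q i i 0) (n + m) le_rfl hn hm⟩
  induction l with
  | nil =>
    by_cases hij : i = j
    · subst hij
      exact ⟨1, by simpa [iteratedBracket] using adF_xTildeMinus_self h i⟩
    · exact hone j 1 hij
  | cons i' l ih =>
    by_cases hij : i = i'
    · subst hij
      obtain ⟨n, hn⟩ := ih
      refine ⟨n, ?_⟩
      rw [iteratedBracket_cons h, ← Module.End.mul_apply, ← pow_succ, pow_succ',
        Module.End.mul_apply, hn, map_zero]
    · obtain ⟨n, hn⟩ := hprod _ _ (hone i' 0 hij) ih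
      obtain ⟨m, hm⟩ := hprod _ _ ih (hone i' 0 hij)
      refine ⟨n + m, ?_⟩
      rw [iteratedBracket, map_sub, map_smul, pow_add, Module.End.mul_apply, Module.End.mul_apply,
        hm, map_zero, smul_zero, sub_zero, ← Module.End.mul_apply, ← pow_add, add_comm, pow_add,
        Module.End.mul_apply, hn, map_zero]

lemma adF_nilpotent (h : IsGenericDatum C d q) (i : I) {β : I → ℤ} {Y : LoopAlgebra C d q}
    (hY : Y ∈ wordSpace C d q β) : ∃ n : ℕ, (adF C d q i ^ n) Y = 0 := by
  induction hY using Submodule.span_induction with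
  | mem Y hY =>
    obtain ⟨l, j, rfl, rfl⟩ := hY
    exact adF_nilpotent_iteratedBracket h i l j
  | zero => exact ⟨0, by simp⟩
  | add Y Z _ _ hY hZ =>
    obtain ⟨n, hn⟩ := hY
    obtain ⟨m, hm⟩ := hZ
    refine ⟨n + m, ?_⟩
    rw [map_add, pow_add, Module.End.mul_apply, Module.End.mul_apply, hm, map_zero, add_zero,
      ← Module.End.mul_apply, ← pow_add, add_comm, pow_add, Module.End.mul_apply, hn, map_zero]
  | smul c Y _ hY =>
    obtain ⟨n, hn⟩ := hY
    exact ⟨n, by rw [map_smul, hn, smul_zero]⟩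

/-- The `α_i`-string through `β`, if it vanishes in negative degrees. -/
lemma isString_wordSpace (h : IsGenericDatum C d q) (i : I) (β : I → ℤ)
    (hβ : ∀ m : ℤ, β ≠ m • Pi.single i 1)
    (hneg : ∀ m : ℤ, m < 0 → wordSpace C d q (β + m • Pi.single i 1) = ⊥) :
    IsString (q ^ d i) (adE C d q i) (adF C d q i)
      (fun m => wordSpace C d q (β + m • Pi.single i 1)) (corootPairing C i β) where
  ne_zero := h.qi_ne_zero i
  pow_ne_one := h.qi_pow_ne_one i
  mapE {m y} hy := by
    -- As `β` is not a multiple of `α_i`, the string never meets the weight `α_i` at which `adE`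
    -- leaves the word spaces.
    have h1 : β + m • Pi.single i 1 ≠ Pi.single i 1 := by
      intro h2
      apply hβ (1 - m)
      rw [sub_smul, one_smul]
      exact eq_sub_of_add_eq h2
    have := adE_mem_wordSpace h i h1 hy
    rwa [add_sub_assoc, sub_eq_add_neg, ← sub_one_zsmul] at this
  mapF {m y} hy := by
    have := adF_mem_wordSpace h i hy
    rwa [add_assoc, ← add_one_zsmul] at this
  rel {m y} hy := by
    have h1 := adE_adF_self h (wordSpace_conj h i hy)
    rw [h1, map_add, map_zsmul, corootPairing_single, h.diag, smul_eq_mul, mul_comm m]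
  eq_zero {m} hm {y} hy := by
    rwa [hneg m hm, Submodule.mem_bot] at hy
  nilpotent {m y} hy := adF_nilpotent h i hy

end WordSpaces

/-! ### Word spaces of roots are lines, all others vanish. -/

section RootSet

variable {I : Type*} [DecidableEq I]

variable {C : Matrix I I ℤ} {d : I → ℕ} {q : ℂ}

lemma ne_zsmul_single_of_add {i : I} {β : I → ℤ} (hi : ∀ m : ℤ, β ≠ m • Pi.single i 1) (m : ℤ) :
    ∀ m' : ℤ, β + m • Pi.single i 1 ≠ m' • Pi.single i 1 := by
  intro m' h
  apply hi (m' - m)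
  rw [sub_smul]
  exact eq_sub_of_add_eq h

lemma eq_smul_single_of_forall {i : I} {β : I → ℤ} (h : ∀ j, j ≠ i → β j = 0) :
    β = β i • Pi.single i 1 := by
  ext j
  by_cases hj : j = i
  · subst hj; simp
  · simp [hj, h j hj]

lemma wordSpace_eq_bot_of_not_nonneg {β : I → ℤ} (hβ : ¬ 0 ≤ β) : wordSpace C d q β = ⊥ := by
  rw [wordSpace, Submodule.span_eq_bot]
  rintro _ ⟨l, j, rfl, rfl⟩
  exact absurd (wordWeight_nonneg l j) hβ

variable [Fintype I] {R : Set (I → ℤ)}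

/-- The properties of the set of roots, in coordinates with respect to the simple roots, that
determine the weights of the adjoint action. -/
structure IsRootSet (C : Matrix I I ℤ) (R : Set (I → ℤ)) : Prop where
  exists_pos {β : I → ℤ} (hβ : 0 ≤ β) (h0 : β ≠ 0) : ∃ i, 0 < β i ∧ 0 < corootPairing C i β
  simple (i : I) : Pi.single i 1 ∈ R
  multiple {i : I} {m : ℤ} (hm : m • Pi.single i 1 ∈ R) : m = 1 ∨ m = -1
  zero_notMem : (0 : I → ℤ) ∉ R
  sign {β : I → ℤ} (hβ : β ∈ R) : 0 ≤ β ∨ β ≤ 0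
  string {β : I → ℤ} (hβ : β ∈ R) (i : I) (hi : ∀ m : ℤ, β ≠ m • Pi.single i 1) :
    ∃ p r : ℕ, (p : ℤ) - r = corootPairing C i β ∧
      ∀ m : ℤ, β + m • Pi.single i 1 ∈ R ↔ -(p : ℤ) ≤ m ∧ m ≤ r

namespace IsRootSet

/-- Some coordinate of `β` away from `i` is positive and is not changed along the `α_i`-string. -/
lemma nonneg_of_add (hR : IsRootSet C R) {i : I} {β : I → ℤ} (hβ : 0 ≤ β)
    (hi : ∀ m : ℤ, β ≠ m • Pi.single i 1) {m : ℤ} (hm : β + m • Pi.single i 1 ∈ R) :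
    0 ≤ β + m • Pi.single i 1 := by
  refine (hR.sign hm).resolve_right fun hle => hi (β i) (eq_smul_single_of_forall fun j hj => ?_)
  have h1 := hle j
  have h2 := hβ j
  simp [hj] at h1 h2
  omega

/-- If `β` is not a root and `⟨β, α_i^∨⟩ ≤ m` with `0 ≤ m`, then `β - m α_i` is not a root. -/
lemma sub_notMem (hR : IsRootSet C R) {i : I} (hC : C i i = 2) {β : I → ℤ} (hβ : β ∉ R)
    (hi : ∀ m : ℤ, β ≠ m • Pi.single i 1) {m : ℤ} (hm : corootPairing C i β ≤ m) (h0 : 0 ≤ m) :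
    β + (-m) • Pi.single i 1 ∉ R := by
  intro h
  obtain ⟨p, r, hpr, hiff⟩ := hR.string h i (ne_zsmul_single_of_add hi _)
  rw [map_add, map_zsmul, corootPairing_single, hC, smul_eq_mul] at hpr
  have := (hiff m).mpr ⟨by omega, by omega⟩
  rw [add_assoc, ← add_smul, neg_add_cancel, zero_smul, add_zero] at this
  exact hβ this

lemma add_mem_of_neg (hR : IsRootSet C R) {i : I} {β : I → ℤ} (hβ : β ∈ R)
    (hi : ∀ m : ℤ, β ≠ m • Pi.single i 1) (h : corootPairing C i β < 0) :
    β + Pi.single i 1 ∈ R := by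
  obtain ⟨p, r, hpr, hiff⟩ := hR.string hβ i hi
  simpa using (hiff 1).mpr ⟨by omega, by omega⟩

lemma sub_mem_of_pos (hR : IsRootSet C R) {i : I} {β : I → ℤ} (hβ : β ∈ R)
    (hi : ∀ m : ℤ, β ≠ m • Pi.single i 1) (h : 0 < corootPairing C i β) :
    β - Pi.single i 1 ∈ R := by
  obtain ⟨p, r, hpr, hiff⟩ := hR.string hβ i hi
  simpa [sub_eq_add_neg] using (hiff (-1)).mpr ⟨by omega, by omega⟩

lemma eq_single_of_nonneg (hR : IsRootSet C R) {i : I} {m : ℤ} (hm : m • Pi.single i 1 ∈ R)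
    (h0 : 0 ≤ m • (Pi.single i 1 : I → ℤ)) : m = 1 := by
  have h1 := h0 i
  simp at h1
  have := hR.multiple hm
  omega

/-- A positive root that is smaller than another root can be raised by a simple root. -/
lemma exists_add_single_mem (hR : IsRootSet C R) (hC : ∀ i, C i i = 2) {β : I → ℤ} (hβ : β ∈ R)
    (hβ0 : 0 ≤ β) (n : ℕ) : ∀ {γ : I → ℤ}, γ ∈ R → β ≤ γ → β ≠ γ → ∑ j, (γ j - β j) ≤ n →
      ∃ i, β + Pi.single i 1 ∈ R ∧ β + Pi.single i 1 ≤ γ := by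
  induction n with
  | zero =>
    intro γ _ hle hne hsum
    have h0 : ∀ j ∈ Finset.univ, 0 ≤ γ j - β j := fun j _ => sub_nonneg.mpr (hle j)
    have h1 := (Finset.sum_eq_zero_iff_of_nonneg h0).mp
      (le_antisymm (by simpa using hsum) (Finset.sum_nonneg h0))
    exact absurd (funext fun j => by have := h1 j (Finset.mem_univ j); omega) hne
  | succ n ih =>
    intro γ hγ hle hne hsum
    -- Since `⟨γ - β, α_i^∨⟩ > 0`, either `⟨γ, α_i^∨⟩ > 0` and `γ` can be lowered to the root `γ -
    -- α_i`, or `⟨β, α_i^∨⟩ < 0` and `β + α_i` is a root.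
    obtain ⟨i, hi, hpair⟩ := hR.exists_pos (β := γ - β) (sub_nonneg.mpr hle)
      (sub_ne_zero.mpr (Ne.symm hne))
    have hlei : β + Pi.single i 1 ≤ γ := by
      intro j
      have := hle j
      by_cases hj : j = i
      · subst hj
        simp at hi ⊢
        omega
      · simpa [hj] using this
    have hγ0 : 0 ≤ γ := hβ0.trans hle
    have hγi : ∀ m : ℤ, γ ≠ m • Pi.single i 1 := by
      rintro m rfl
      obtain rfl := hR.eq_single_of_nonneg hγ hγ0
      have h1 : β = β i • Pi.single i 1 := eq_smul_single_of_forall fun j hj => by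
        have h1 := hle j
        have h2 := hβ0 j
        simp [hj] at h1 h2
        omega
      have h2 := hR.eq_single_of_nonneg (h1 ▸ hβ) (h1 ▸ hβ0)
      rw [h2] at h1
      exact hne h1
    by_cases hpos : 0 < corootPairing C i γ
    · by_cases heq : β + Pi.single i 1 = γ
      · exact ⟨i, heq ▸ hγ, hlei⟩
      have hmem := hR.sub_mem_of_pos hγ hγi hpos
      obtain ⟨i', h1, h2⟩ := ih hmem (le_sub_iff_add_le.mpr hlei)
        (fun h => heq (by rw [h, sub_add_cancel])) (by
          have : ∑ j, ((γ - Pi.single i 1 : I → ℤ) j - β j) = ∑ j, (γ j - β j) - 1 := by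
            simp [Finset.sum_sub_distrib, sub_right_comm]
          rw [this]
          push_cast at hsum
          omega)
      exact ⟨i', h1, h2.trans (sub_le_self _ (by simp))⟩
    · have hneg : corootPairing C i β < 0 := by
        rw [map_sub] at hpair
        omega
      have hβi : ∀ m : ℤ, β ≠ m • Pi.single i 1 := by
        rintro m rfl
        obtain rfl := hR.eq_single_of_nonneg hβ hβ0
        simp [hC] at hneg
      exact ⟨i, hR.add_mem_of_neg hβ hβi hneg, hlei⟩

end IsRootSet

/-- The word has at least two letters, all equal to `i`, so its innermost step is `adF` applied to
`x̃⁻_{i,1}`, which is zero. -/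
lemma iteratedBracket_eq_zero_of_multiple (h : IsGenericDatum C d q) {i : I} (l : List I)
    (i' j : I) (hw : ∀ j', j' ≠ i → wordWeight (i' :: l) j j' = 0) :
    iteratedBracket C d q (i' :: l) j = 0 := by
  have hi' : i' = i := by
    by_contra hne
    have h1 := hw i' hne
    have h2 := wordWeight_nonneg l j i'
    simp [wordWeight] at h1 h2
    omega
  subst hi'
  have hw' : ∀ j', j' ≠ i' → wordWeight l j j' = 0 := fun j' hj' => by
    simpa [wordWeight, hj'] using hw j' hj'
  rw [iteratedBracket_cons h]
  cases l with
  | nil =>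
    have : j = i' := by
      by_contra hne
      simpa [wordWeight] using hw' j hne
    subst this
    exact adF_xTildeMinus_self h j
  | cons i l => rw [iteratedBracket_eq_zero_of_multiple h l i j hw', map_zero]

lemma wordSpace_eq_bot_of_multiple (h : IsGenericDatum C d q) {i : I} {m : ℤ} (hm : m ≠ 1) :
    wordSpace C d q (m • Pi.single i 1) = ⊥ := by
  rw [wordSpace, Submodule.span_eq_bot]
  rintro _ ⟨l, j, hw, rfl⟩
  cases l with
  | nil =>
    exfalso
    have h1 := wordWeight_sum [] j
    rw [hw] at h1
    apply hm
    simpa [← Finset.mul_sum] using h1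
  | cons i' l =>
    refine iteratedBracket_eq_zero_of_multiple h (i := i) l i' j fun j' hj' => ?_
    rw [hw]
    simp [hj']

lemma wordSpace_single (i : I) :
    wordSpace C d q (Pi.single i 1) = Submodule.span ℂ {xTildeMinus C d q i 1} := by
  rw [wordSpace]
  congr 1
  ext Y
  constructor
  · rintro ⟨l, j, hw, rfl⟩
    obtain ⟨rfl, rfl⟩ := eq_nil_of_wordWeight_eq_single hw
    rfl
  · rintro rfl
    exact ⟨[], i, rfl, rfl⟩

lemma wordSpace_zero : wordSpace C d q (0 : I → ℤ) = ⊥ := by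
  rw [wordSpace, Submodule.span_eq_bot]
  rintro _ ⟨l, j, hw, rfl⟩
  have h1 := wordWeight_sum l j
  rw [hw] at h1
  simp at h1
  omega

/-- The word spaces of positive roots are lines, and the other word spaces vanish. -/
lemma wordSpace_spec (h : IsGenericDatum C d q) (hR : IsRootSet C R)
    (hx : ∀ j, xTildeMinus C d q j 1 ≠ 0) (n : ℕ) : ∀ β : I → ℤ, ∑ j, β j ≤ n →
      (β ∉ R → wordSpace C d q β = ⊥) ∧
      (β ∈ R → 0 ≤ β → ∃ v, v ≠ 0 ∧ wordSpace C d q β = Submodule.span ℂ {v}) := by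
  induction n with
  | zero =>
    intro β hsum
    by_cases hβ : 0 ≤ β
    · have : β = 0 := by
        have h1 := (Finset.sum_eq_zero_iff_of_nonneg (fun j _ => hβ j)).mp
          (le_antisymm (by simpa using hsum) (Finset.sum_nonneg fun j _ => hβ j))
        exact funext fun j => h1 j (Finset.mem_univ j)
      subst this
      exact ⟨fun _ => wordSpace_zero, fun h0 => absurd h0 hR.zero_notMem⟩
    · exact ⟨fun _ => wordSpace_eq_bot_of_not_nonneg hβ, fun _ h0 => absurd h0 hβ⟩
  | succ n ih =>
    intro β hsum
    by_cases hβ : 0 ≤ β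
    swap
    · exact ⟨fun _ => wordSpace_eq_bot_of_not_nonneg hβ, fun _ h0 => absurd h0 hβ⟩
    by_cases hβ0 : β = 0
    · subst hβ0
      exact ⟨fun _ => wordSpace_zero, fun h0 => absurd h0 hR.zero_notMem⟩
    obtain ⟨i, hi, hpair⟩ := hR.exists_pos hβ hβ0
    by_cases hmul : ∃ m : ℤ, β = m • Pi.single i 1
    · obtain ⟨m, rfl⟩ := hmul
      by_cases hm : m = 1
      · subst hm
        simp only [one_smul]
        exact ⟨fun h0 => absurd (hR.simple i) h0, fun _ _ => ⟨_, hx i, wordSpace_single i⟩⟩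
      · exact ⟨fun _ => wordSpace_eq_bot_of_multiple h hm,
          fun h0 _ => absurd (hR.eq_single_of_nonneg h0 hβ) hm⟩
    push Not at hmul
    have hlow : ∀ m : ℤ, m < 0 → ∑ j, (β + m • Pi.single i 1 : I → ℤ) j ≤ n := by
      intro m hm
      simp [Finset.sum_add_distrib, ← Finset.mul_sum] at hsum ⊢
      omega
    set a := corootPairing C i β with ha
    refine ⟨fun hβR => ?_, fun hβR _ => ?_⟩
    -- If `β` is not a root, neither is `β - mα_i` for `m ≥ a`. By induction the string based at `β
    -- - (a - 1)α_i` vanishes in negative degrees. Its exponent is `2 - a`, so it ends in degree `a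
    -- - 2`, just before `β` in degree `a - 1`.
    · have hneg : ∀ m : ℤ, m < 0 →
          wordSpace C d q (β + (1 - a) • Pi.single i 1 + m • Pi.single i 1) = ⊥ := by
        intro m hm
        rw [add_assoc, ← add_smul]
        refine (ih _ (hlow _ (by omega))).1 ?_
        have := hR.sub_notMem (h.diag i) hβR hmul (m := a - 1 - m) (by omega) (by omega)
        rwa [show -(a - 1 - m) = 1 - a + m by ring] at this
      have hs := isString_wordSpace h i _ (ne_zsmul_single_of_add hmul (1 - a)) hneg
      rw [eq_bot_iff]
      intro y hy
      refine hs.eq_zero_of_neg_lt (k := a - 1) ?_ ?_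
      · rw [map_add, map_zsmul, corootPairing_single, h.diag, smul_eq_mul, ← ha]
        omega
      · rwa [add_assoc, ← add_smul, sub_add_sub_cancel, sub_self, zero_smul, add_zero]
    · obtain ⟨p, r, hpr, hiff⟩ := hR.string hβR i hmul
      -- `p - r = a > 0` forces `p ≥ 1`. After the renaming, `β` sits in degree `p + 1` of its
      -- string, and the degrees `0, …, p` are lines by induction.
      obtain ⟨p, rfl⟩ : ∃ p', p = p' + 1 := ⟨p - 1, by omega⟩
      have hsub : ∀ m : ℤ, β + (-((p + 1 : ℕ) : ℤ)) • Pi.single i 1 + m • Pi.single i 1 =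
          β + (m - (p + 1)) • Pi.single i 1 := by
        intro m
        rw [add_assoc, ← add_smul]
        congr 2
        push_cast
        ring
      have hneg : ∀ m : ℤ, m < 0 → wordSpace C d q
          (β + (-((p + 1 : ℕ) : ℤ)) • Pi.single i 1 + m • Pi.single i 1) = ⊥ := by
        intro m hm
        rw [hsub]
        refine (ih _ (hlow _ (by omega))).1 fun h1 => ?_
        have := (hiff _).mp h1
        omega
      have hs := isString_wordSpace h i _
        (ne_zsmul_single_of_add hmul (-((p + 1 : ℕ) : ℤ))) hneg
      have hb : corootPairing C i (β + (-((p + 1 : ℕ) : ℤ)) • Pi.single i 1) =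
          -(p + 1 + r : ℤ) := by
        rw [map_add, map_zsmul, corootPairing_single, h.diag, smul_eq_mul, ← ha]
        push_cast at hpr ⊢
        omega
      rw [hb] at hs
      have hline : ∀ m : ℤ, 0 ≤ m → m < p + 1 → ∃ v, v ≠ 0 ∧ wordSpace C d q
          (β + (-((p + 1 : ℕ) : ℤ)) • Pi.single i 1 + m • Pi.single i 1) =
            Submodule.span ℂ {v} := by
        intro m h0 hm
        rw [hsub]
        have hm' := (hiff (m - (p + 1))).mpr ⟨by omega, by omega⟩
        exact (ih _ (hlow _ (by omega))).2 hm' (hR.nonneg_of_add hβ hmul hm')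
      obtain ⟨v, hv0, hv⟩ := hline 0 le_rfl (by omega)
      have hvmem : v ∈ (fun m : ℤ => wordSpace C d q
          (β + (-((p + 1 : ℕ) : ℤ)) • Pi.single i 1 + m • Pi.single i 1)) 0 := by
        change v ∈ wordSpace C d q _
        rw [hv]
        exact Submodule.mem_span_singleton_self v
      have hEv := hs.eq_zero (by norm_num) (hs.mapE hvmem)
      obtain ⟨hp0, hp⟩ := hs.eq_span_powF hvmem hv0 (n := p) (by omega)
        (hline p (by omega) (by omega))
      have hFmem := hs.powF_mem hvmem (p + 1)
      have hFne := hs.powF_ne_zero hvmem hEv hv0 (n := p + 1) fun m hm => by omega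
      have hend : β + (-((p + 1 : ℕ) : ℤ)) • Pi.single i 1 + (0 + ((p + 1 : ℕ) : ℤ)) • Pi.single i 1
          = β := by
        rw [add_assoc, ← add_smul]
        simp
      refine ⟨_, hFne, le_antisymm ?_ ?_⟩
      · intro y hy
        have hy' : y ∈ wordSpace C d q
            (β + (-((p + 1 : ℕ) : ℤ)) • Pi.single i 1 + (0 + ((p + 1 : ℕ) : ℤ)) • Pi.single i 1) := by
          rwa [hend]
        -- Subtracting a multiple of `F^{p+1} v` from `y` gives a vector killed by `E`; it vanishes
        -- because the exponent at `β` is `a > 0`.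
        obtain ⟨c, hc0, hc⟩ := hs.exists_E_powF hvmem hEv (n := p) (by omega)
        have hEy := hs.mapE hy'
        rw [show (0 + ((p + 1 : ℕ) : ℤ) - 1) = p by push_cast; ring, hp,
          Submodule.mem_span_singleton] at hEy
        obtain ⟨e, he⟩ := hEy
        have hker : adE C d q i (y - (e * c⁻¹) • (adF C d q i ^ (p + 1)) v) = 0 := by
          rw [map_sub, map_smul, hc, smul_smul, mul_assoc, inv_mul_cancel₀ hc0, mul_one, he, sub_self]
        have hzero := hs.eq_zero_of_E_eq_zero (sub_mem hy' (Submodule.smul_mem _ _ hFmem)) hker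
          (by push_cast at hpr ⊢; omega)
        rw [Submodule.mem_span_singleton]
        exact ⟨_, (sub_eq_zero.mp hzero).symm⟩
      · rw [Submodule.span_singleton_le_iff_mem]
        have := hFmem
        simp only [hend] at this
        exact this

lemma wordSpace_eq_bot (h : IsGenericDatum C d q) (hR : IsRootSet C R)
    (hx : ∀ j, xTildeMinus C d q j 1 ≠ 0) {β : I → ℤ} (hβ : β ∉ R) : wordSpace C d q β = ⊥ :=
  (wordSpace_spec h hR hx _ β (Int.self_le_toNat _)).1 hβ

lemma wordSpace_eq_span (h : IsGenericDatum C d q) (hR : IsRootSet C R)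
    (hx : ∀ j, xTildeMinus C d q j 1 ≠ 0) {β : I → ℤ} (hβ : β ∈ R) (h0 : 0 ≤ β) :
    ∃ v, v ≠ 0 ∧ wordSpace C d q β = Submodule.span ℂ {v} :=
  (wordSpace_spec h hR hx _ β (Int.self_le_toNat _)).2 hβ h0

/-- Raising and lowering operators are surjective between the word spaces of adjacent positive
roots. -/
lemma wordSpace_map (h : IsGenericDatum C d q) (hR : IsRootSet C R)
    (hx : ∀ j, xTildeMinus C d q j 1 ≠ 0) {β : I → ℤ} {i : I} (hβ : β ∈ R) (h0 : 0 ≤ β)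
    (hβi : β + Pi.single i 1 ∈ R) :
    wordSpace C d q (β + Pi.single i 1) ≤ (wordSpace C d q β).map (adF C d q i) ∧
      wordSpace C d q β ≤ (wordSpace C d q (β + Pi.single i 1)).map (adE C d q i) := by
  have hmul : ∀ m : ℤ, β ≠ m • Pi.single i 1 := by
    rintro m rfl
    obtain rfl := hR.eq_single_of_nonneg hβ h0
    rw [← add_one_zsmul] at hβi
    have := hR.multiple hβi
    omega
  obtain ⟨p, r, hpr, hiff⟩ := hR.string hβ i hmul
  have hr : 1 ≤ r := by
    have := (hiff 1).mp (by simpa using hβi)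
    omega
  have hsub : ∀ m : ℤ, β + (-(p : ℤ)) • Pi.single i 1 + m • Pi.single i 1 =
      β + (m - p) • Pi.single i 1 := by
    intro m
    rw [add_assoc, ← add_smul]
    congr 2
    ring
  have hs := isString_wordSpace h i _ (ne_zsmul_single_of_add hmul (-(p : ℤ))) fun m hm => by
    rw [hsub]
    refine wordSpace_eq_bot h hR hx fun h1 => ?_
    have := (hiff _).mp h1
    omega
  have hb : corootPairing C i (β + (-(p : ℤ)) • Pi.single i 1) = -(p + r : ℤ) := by
    rw [map_add, map_zsmul, corootPairing_single, h.diag, smul_eq_mul]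
    omega
  rw [hb] at hs
  have hline : ∀ m : ℤ, 0 ≤ m → m ≤ p + r → ∃ v, v ≠ 0 ∧ wordSpace C d q
      (β + (-(p : ℤ)) • Pi.single i 1 + m • Pi.single i 1) = Submodule.span ℂ {v} := by
    intro m h1 hm
    rw [hsub]
    have hm' := (hiff (m - p)).mpr ⟨by omega, by omega⟩
    exact wordSpace_eq_span h hR hx hm' (hR.nonneg_of_add h0 hmul hm')
  obtain ⟨v, hv0, hv⟩ := hline 0 le_rfl (by omega)
  have hvmem : v ∈ (fun m : ℤ => wordSpace C d q
      (β + (-(p : ℤ)) • Pi.single i 1 + m • Pi.single i 1)) 0 := by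
    change v ∈ wordSpace C d q _
    rw [hv]
    exact Submodule.mem_span_singleton_self v
  have hEv := hs.eq_zero (by norm_num) (hs.mapE hvmem)
  -- The roots `β` and `β + α_i` sit in degrees `p` and `p + 1`, and both lines are spanned by
  -- images of the bottom vector `v`.
  obtain ⟨-, hp⟩ := hs.eq_span_powF hvmem hv0 (n := p) (by omega) (hline p (by omega) (by omega))
  obtain ⟨-, hp1⟩ := hs.eq_span_powF hvmem hv0 (n := p + 1) (by push_cast; omega)
    (hline (p + 1 : ℕ) (by omega) (by push_cast; omega))
  obtain ⟨c, hc0, hc⟩ := hs.exists_E_powF hvmem hEv (n := p) (by omega)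
  have e1 : β + (-(p : ℤ)) • Pi.single i 1 + (p : ℤ) • Pi.single i 1 = β := by
    rw [hsub]; simp
  have e2 : β + (-(p : ℤ)) • Pi.single i 1 + ((p + 1 : ℕ) : ℤ) • Pi.single i 1 =
      β + Pi.single i 1 := by
    rw [hsub]; simp
  simp only [e1] at hp
  simp only [e2] at hp1
  rw [hp, hp1]
  constructor
  · rw [Submodule.span_singleton_le_iff_mem, Submodule.map_span, Set.image_singleton, pow_succ',
      Module.End.mul_apply]
    exact Submodule.mem_span_singleton_self _
  · rw [Submodule.span_singleton_le_iff_mem, Submodule.map_span, Set.image_singleton, hc,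
      Submodule.span_singleton_smul_eq (IsUnit.mk0 c hc0)]
    exact Submodule.mem_span_singleton_self _

end RootSet

/-! ### Drinfeld generators contained in the Borel algebra. -/

section Borel

variable {I : Type*} {C : Matrix I I ℤ} {d : I → ℕ} {q : ℂ} {l : List I} {j₀ : I}

lemma xPlus_zero_mem_borel (i : I) : xPlus C d q i 0 ∈ borel C d q l j₀ :=
  Algebra.subset_adjoin (Or.inl (Or.inl (Or.inl ⟨i, rfl⟩)))

lemma k_mem_borel (i : I) : k C d q i ∈ borel C d q l j₀ :=
  Algebra.subset_adjoin (Or.inl (Or.inl (Or.inr ⟨i, rfl⟩)))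

lemma kInv_mem_borel (i : I) : kInv C d q i ∈ borel C d q l j₀ :=
  Algebra.subset_adjoin (Or.inl (Or.inr ⟨i, rfl⟩))

lemma iteratedBracket_mem_borel : iteratedBracket C d q l j₀ ∈ borel C d q l j₀ :=
  Algebra.subset_adjoin (Or.inr rfl)

lemma adE_mem_borel (i : I) {Y : LoopAlgebra C d q} (hY : Y ∈ borel C d q l j₀) :
    adE C d q i Y ∈ borel C d q l j₀ := by
  rw [adE, twistedAd_apply]
  exact sub_mem (mul_mem (xPlus_zero_mem_borel i) hY)
    (mul_mem (mul_mem (kInv_mem_borel i) hY) (mul_mem (k_mem_borel i) (xPlus_zero_mem_borel i)))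

/-- If one of the elements `x̃⁻_{j,1}` vanishes, then all of them do. -/
lemma xTildeMinus_one_eq_zero (h : IsGenericDatum C d q)
    (hconn : ∀ p : I → Prop, (∃ i, p i) → (∀ i j, p i → C i j ≠ 0 → p j) → ∀ j, p j)
    {i : I} (hi : xTildeMinus C d q i 1 = 0) (j : I) : xTildeMinus C d q j 1 = 0 := by
  refine hconn (fun i => xTildeMinus C d q i 1 = 0) ⟨i, hi⟩ (fun i j hi hij => ?_) j
  -- Vanishing propagates from `x̃⁻_{i,1}` to `φ̃⁺_{i,1}` by `adE`, and from there by `adF` to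
  -- `x̃⁻_{j,1}` for each neighbour `j` of `i`.
  have h1 := adE_xTildeMinus_self h i
  rw [hi, map_zero, eq_comm, smul_eq_zero_iff_right (mul_ne_zero
    (zpow_ne_zero _ (h.qi_ne_zero i)) (inv_ne_zero (h.qi_sub_inv_ne_zero i)))] at h1
  have h2 := adF_phiTilde (C := C) (d := d) (q := q) i j
  rw [h1, map_zero, eq_comm, smul_eq_zero_iff_right (h.qi_zpow_sub_ne_zero i hij)] at h2
  exact h2

/-- All suffixes of the word have roots as weights, so by `wordSpace_map` each further letter maps
one word space onto the next. -/
lemma wordSpace_wordWeight [Fintype I] [DecidableEq I] {R : Set (I → ℤ)}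
    (h : IsGenericDatum C d q) (hR : IsRootSet C R) (hx : ∀ j, xTildeMinus C d q j 1 ≠ 0)
    (hl : ∀ l', l' <:+ l → wordWeight l' j₀ ∈ R) :
    wordSpace C d q (wordWeight l j₀) = Submodule.span ℂ {iteratedBracket C d q l j₀} := by
  induction l with
  | nil => exact wordSpace_single j₀
  | cons i l ih =>
    have ih' := ih fun l' hl' => hl l' (hl'.trans (List.suffix_cons i l))
    refine le_antisymm ?_ ?_
    · have h1 := (wordSpace_map h hR hx (hl l (List.suffix_cons i l)) (wordWeight_nonneg l j₀)
        (hl (i :: l) List.suffix_rfl)).1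
      rwa [ih', Submodule.map_span, Set.image_singleton, ← iteratedBracket_cons h] at h1
    · rw [Submodule.span_singleton_le_iff_mem]
      exact iteratedBracket_mem_wordSpace (i :: l) j₀

/-- Descent from `e₀`: a positive root `β` other than the maximal one can be raised to a root `β +
α_i`, and `adE` maps the word space of the latter onto that of `β` without leaving the Borel
algebra. The induction is on the height gap. -/
lemma wordSpace_le_borel [Fintype I] [DecidableEq I] {R : Set (I → ℤ)}
    (h : IsGenericDatum C d q) (hR : IsRootSet C R) (hx : ∀ j, xTildeMinus C d q j 1 ≠ 0)
    (hl : ∀ l', l' <:+ l → wordWeight l' j₀ ∈ R) (hmax : ∀ β ∈ R, β ≤ wordWeight l j₀) (n : ℕ) :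
    ∀ β ∈ R, 0 ≤ β → ∑ j, (wordWeight l j₀ j - β j) ≤ n →
      ∀ Y ∈ wordSpace C d q β, Y ∈ borel C d q l j₀ := by
  have hθ : ∀ Y ∈ wordSpace C d q (wordWeight l j₀), Y ∈ borel C d q l j₀ := by
    intro Y hY
    rw [wordSpace_wordWeight h hR hx hl, Submodule.mem_span_singleton] at hY
    obtain ⟨c, rfl⟩ := hY
    exact Subalgebra.smul_mem _ iteratedBracket_mem_borel c
  have hstep : ∀ β ∈ R, 0 ≤ β → β ≠ wordWeight l j₀ → ∃ i, β + Pi.single i 1 ∈ R := by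
    intro β hβ h0 hne
    obtain ⟨i, hi, -⟩ := hR.exists_add_single_mem h.diag hβ h0 _ (hl l List.suffix_rfl)
      (hmax β hβ) hne (Int.self_le_toNat _)
    exact ⟨i, hi⟩
  have hnext : ∀ β ∈ R, 0 ≤ β → ∀ i, β + Pi.single i 1 ∈ R →
      (∀ Y ∈ wordSpace C d q (β + Pi.single i 1), Y ∈ borel C d q l j₀) →
        ∀ Y ∈ wordSpace C d q β, Y ∈ borel C d q l j₀ := by
    intro β hβ h0 i hi hb Y hY
    obtain ⟨Z, hZ, rfl⟩ := (wordSpace_map h hR hx hβ h0 hi).2 hY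
    exact adE_mem_borel i (hb Z hZ)
  induction n with
  | zero =>
    intro β hβ h0 hsum
    by_cases hne : β = wordWeight l j₀
    · rwa [hne]
    · obtain ⟨i, hi⟩ := hstep β hβ h0 hne
      have h1 : ∑ j, (β + Pi.single i 1 : I → ℤ) j ≤ ∑ j, wordWeight l j₀ j :=
        Finset.sum_le_sum fun j _ => hmax _ hi j
      simp [Finset.sum_add_distrib, Finset.sum_sub_distrib] at h1 hsum
      omega
  | succ n ih =>
    intro β hβ h0 hsum
    by_cases hne : β = wordWeight l j₀
    · rwa [hne]
    · obtain ⟨i, hi⟩ := hstep β hβ h0 hne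
      refine hnext β hβ h0 i hi (ih _ hi (add_nonneg h0 (by simp)) ?_)
      simp [Finset.sum_add_distrib, Finset.sum_sub_distrib] at hsum ⊢
      omega

lemma xTildeMinus_one_mem_borel [Fintype I] [DecidableEq I] {R : Set (I → ℤ)}
    (h : IsGenericDatum C d q) (hR : IsRootSet C R)
    (hconn : ∀ p : I → Prop, (∃ i, p i) → (∀ i j, p i → C i j ≠ 0 → p j) → ∀ j, p j)
    (hl : ∀ l', l' <:+ l → wordWeight l' j₀ ∈ R) (hmax : ∀ β ∈ R, β ≤ wordWeight l j₀) (i : I) :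
    xTildeMinus C d q i 1 ∈ borel C d q l j₀ := by
  by_cases hx : ∀ j, xTildeMinus C d q j 1 ≠ 0
  · refine wordSpace_le_borel h hR hx hl hmax _ _ (hR.simple i) (by simp) (Int.self_le_toNat _) _ ?_
    rw [wordSpace_single]
    exact Submodule.mem_span_singleton_self _
  · push Not at hx
    obtain ⟨j, hj⟩ := hx
    rw [xTildeMinus_one_eq_zero h hconn hj i]
    exact zero_mem _

section Generators

variable (h : IsGenericDatum C d q) (hx : ∀ i, xTildeMinus C d q i 1 ∈ borel C d q l j₀)
include h hx

lemma phiTilde_one_mem_borel (i : I) : phiTilde C d q i 1 ∈ borel C d q l j₀ := by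
  have h1 := adE_mem_borel i (hx i)
  rw [adE_xTildeMinus_self h] at h1
  have := Subalgebra.smul_mem _ h1 ((q ^ d i) ^ (2 : ℤ) * (q ^ d i - (q ^ d i)⁻¹)⁻¹)⁻¹
  rwa [smul_smul, inv_mul_cancel₀ (mul_ne_zero (zpow_ne_zero _ (h.qi_ne_zero i))
    (inv_ne_zero (h.qi_sub_inv_ne_zero i))), one_smul] at this

/-- The commutator with `φ̃⁺_{i,1}` raises the loop index by one, with the non-zero coefficient
`q_i² - q_i⁻²`. -/
lemma xPlus_mem_borel (i : I) (r : ℕ) : xPlus C d q i r ∈ borel C d q l j₀ := by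
  induction r with
  | zero => exact xPlus_zero_mem_borel i
  | succ r ih =>
    have hφ := phiTilde_one_mem_borel h hx i
    have h1 := sub_mem (mul_mem hφ ih) (mul_mem ih hφ)
    rw [phiTilde_one_xPlus, add_sub_cancel_left] at h1
    have h2 := Subalgebra.smul_mem _ h1 ((q ^ d i) ^ C i i - (q ^ d i) ^ (-C i i))⁻¹
    rw [smul_smul, inv_mul_cancel₀ (h.qi_zpow_sub_ne_zero i (by rw [h.diag]; norm_num)),
      one_smul] at h2
    exact_mod_cast h2

lemma xTildeMinus_mem_borel (i : I) (r : ℕ) : xTildeMinus C d q i (r + 1) ∈ borel C d q l j₀ := by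
  induction r with
  | zero => simpa using hx i
  | succ r ih =>
    have hφ := phiTilde_one_mem_borel h hx i
    have h1 := sub_mem (mul_mem hφ ih) (mul_mem ih hφ)
    rw [phiTilde_one_xTildeMinus, add_sub_cancel_left, ← neg_sub, neg_smul] at h1
    have h2 := Subalgebra.smul_mem _ (neg_mem h1) ((q ^ d i) ^ C i i - (q ^ d i) ^ (-C i i))⁻¹
    rw [neg_neg, smul_smul, inv_mul_cancel₀ (h.qi_zpow_sub_ne_zero i (by rw [h.diag]; norm_num)),
      one_smul] at h2
    exact_mod_cast h2

lemma phiTilde_mem_borel (i : I) (m : ℕ) : phiTilde C d q i m ∈ borel C d q l j₀ := by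
  cases m with
  | zero => rw [phiTilde_zero]; exact one_mem _
  | succ m =>
    have hp := xPlus_mem_borel h hx i m
    have hm := hx i
    have h1 := sub_mem (Subalgebra.smul_mem _ (mul_mem hp hm) ((q ^ d i) ^ (-C i i)))
      (mul_mem hm hp)
    rw [xPlus_xTildeMinus_of_pos C d q i m 1 (by omega)] at h1
    have h2 := Subalgebra.smul_mem _ h1 (q ^ d i - (q ^ d i)⁻¹)
    rwa [smul_smul, mul_inv_cancel₀ (h.qi_sub_inv_ne_zero i), one_smul,
      show ((m : ℤ) + 1).toNat = m + 1 by omega] at h2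

lemma phiPlus_mem_borel (i : I) (m : ℕ) : phiPlus C d q i m ∈ borel C d q l j₀ := by
  rw [phiPlus_eq]
  exact mul_mem (k_mem_borel i) (phiTilde_mem_borel h hx i m)

end Generators

end Borel

/-! ### The root system in simple-root coordinates. -/

section Roots

variable {ι M N : Type*} [AddCommGroup M] [Module ℂ M] [AddCommGroup N] [Module ℂ N]
  {P : RootPairing ι ℂ M N}

/-- The element `∑ β_j α_j` of the root lattice. -/
def rootCombination (b : P.Base) : (b.support → ℤ) →ₗ[ℤ] M :=
  Fintype.linearCombination ℤ fun j : b.support => P.root j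

lemma rootCombination_apply (b : P.Base) (β : b.support → ℤ) :
    rootCombination b β = ∑ j, β j • P.root j := by
  simp [rootCombination, Fintype.linearCombination_apply]

@[simp] lemma rootCombination_single [DecidableEq ι] (b : P.Base) (i : b.support) :
    rootCombination b (Pi.single i 1) = P.root i := by
  simp [rootCombination]

lemma rootCombination_injective (b : P.Base) : Function.Injective (rootCombination b) :=
  (b.linearIndepOn_root.restrict_scalars' ℤ).fintypeLinearCombination_injective

lemma exists_rootCombination_eq_of_mem_closure (b : P.Base) {x : M}
    (hx : x ∈ AddSubmonoid.closure (P.root '' b.support)) :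
    ∃ β : b.support → ℤ, 0 ≤ β ∧ rootCombination b β = x := by
  classical
  induction hx using AddSubmonoid.closure_induction with
  | mem x hx =>
    obtain ⟨i, hi, rfl⟩ := hx
    exact ⟨Pi.single ⟨i, hi⟩ 1, by simp, rootCombination_single b ⟨i, hi⟩⟩
  | zero => exact ⟨0, le_rfl, map_zero _⟩
  | add x y _ _ hx hy =>
    obtain ⟨β, hβ, rfl⟩ := hx
    obtain ⟨γ, hγ, rfl⟩ := hy
    exact ⟨β + γ, add_nonneg hβ hγ, map_add _ _ _⟩

lemma corootPairing_eq_pairingIn [P.IsCrystallographic] (b : P.Base) (i : b.support)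
    {β : b.support → ℤ} {a : ι} (ha : P.root a = rootCombination b β) :
    corootPairing b.cartanMatrix.transpose i β = P.pairingIn ℤ a i := by
  apply (algebraMap ℤ ℂ).injective_int
  rw [P.algebraMap_pairingIn ℤ, ← P.root_coroot'_eq_pairing, ha, rootCombination_apply, map_sum]
  simp only [corootPairing, AddMonoidHom.coe_mk, ZeroHom.coe_mk, map_sum, map_mul,
    Matrix.transpose_apply, map_zsmul, RootPairing.root_coroot'_eq_pairing,
    RootPairing.Base.algebraMap_cartanMatrixIn_apply]
  refine Finset.sum_congr rfl fun j _ => ?_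
  rw [zsmul_eq_mul, mul_comm]
  simp

lemma rootCombination_wordWeight [DecidableEq ι] (b : P.Base) (l : List b.support)
    (j₀ : b.support) : rootCombination b (wordWeight l j₀) = wordRoot b l j₀ := by
  induction l with
  | nil => simp [wordWeight, wordRoot]
  | cons i l ih =>
    simp only [wordWeight, map_add, ih, rootCombination_single, wordRoot, List.bind_eq_flatMap,
      List.pure_def, List.flatMap_cons, List.map_append, List.map_cons, List.map_nil,
      List.sum_append, List.sum_cons, List.sum_nil]
    abel

/-- The set of roots in coordinates with respect to the simple roots. -/
def rootCoordinates (b : P.Base) : Set (b.support → ℤ) :=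
  {β | rootCombination b β ∈ Set.range P.root}

lemma isRootSet_rootCoordinates [Finite ι] [DecidableEq ι] [P.IsRootSystem] [P.IsCrystallographic]
    [P.IsReduced] (b : P.Base) :
    IsRootSet b.cartanMatrix.transpose (rootCoordinates b) where
  exists_pos {β} hβ h0 := by
    -- The positive definite form at `β` equals `∑ D_i β_i ⟨β, α_i^∨⟩`, so one summand is positive;
    -- as `D_i > 0` and `β_i ≥ 0`, both other factors are positive.
    obtain ⟨D, hD, hpos⟩ := b.exists_cartanMatrix_mul_diagaonal_posDef
    have h1 := hpos.dotProduct_mulVec_pos h0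
    have h2 : star β ⬝ᵥ (b.cartanMatrix * Matrix.diagonal D).mulVec β =
        ∑ i, D i * (β i * corootPairing b.cartanMatrix.transpose i β) := by
      simp only [dotProduct, Matrix.mulVec, Matrix.mul_diagonal, corootPairing, AddMonoidHom.coe_mk,
        ZeroHom.coe_mk, Finset.mul_sum, Matrix.transpose_apply]
      rw [Finset.sum_comm]
      refine Finset.sum_congr rfl fun i _ => Finset.sum_congr rfl fun j _ => ?_
      simp
      ring
    rw [h2] at h1
    obtain ⟨i, -, hi⟩ := Finset.exists_lt_of_sum_lt (s := Finset.univ) (f := fun _ => (0 : ℤ))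
      (g := fun i => D i * (β i * corootPairing b.cartanMatrix.transpose i β))
      (by rw [Finset.sum_const_zero]; exact h1)
    have h3 := pos_of_mul_pos_right hi (hD i).le
    have h4 : 0 < β i := lt_of_le_of_ne (hβ i) fun h => by
      rw [← h] at h3
      simp at h3
    exact ⟨i, h4, pos_of_mul_pos_right h3 (hβ i)⟩
  simple i := ⟨i, by simp⟩
  multiple {i m} hm := by
    have : Module.IsReflexive ℂ M := .of_isPerfPair P.toLinearMap
    have : Module.IsReflexive ℂ N := .of_isPerfPair P.flip.toLinearMap
    have : IsAddTorsionFree M := .of_isTorsionFree ℂ M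
    have : IsAddTorsionFree N := .of_isTorsionFree ℂ N
    have h1 : (m : ℂ) • P.root i ∈ Set.range P.root := by
      have h1 : rootCombination b (m • Pi.single i 1) ∈ Set.range P.root := hm
      rwa [map_zsmul, rootCombination_single, ← Int.cast_smul_eq_zsmul ℂ] at h1
    have h2 := b.eq_one_or_neg_one_of_mem_support_of_smul_mem i i.2 m h1
    exact_mod_cast h2
  zero_notMem h := by
    obtain ⟨a, ha⟩ : rootCombination b 0 ∈ Set.range P.root := h
    rw [map_zero] at ha
    exact P.ne_zero a ha
  sign {β} hβ := by
    obtain ⟨a, ha⟩ := hβ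
    rcases b.root_mem_or_neg_mem a with h | h
    · obtain ⟨γ, hγ, h1⟩ := exists_rootCombination_eq_of_mem_closure b h
      left
      rwa [← rootCombination_injective b (h1.trans ha)]
    · obtain ⟨γ, hγ, h1⟩ := exists_rootCombination_eq_of_mem_closure b h
      right
      rw [ha, ← map_neg] at h1
      rw [rootCombination_injective b h1] at hγ
      simpa using hγ
  string {β} hβ i hi := by
    obtain ⟨a, ha⟩ := hβ
    have hlin : LinearIndependent ℂ ![P.root i, P.root a] := by
      refine RootPairing.IsReduced.linearIndependent P ?_ ?_
      · intro h
        apply hi 1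
        apply rootCombination_injective b
        rw [← ha, ← h, one_smul, rootCombination_single]
      · intro h
        apply hi (-1)
        apply rootCombination_injective b
        rw [← ha, neg_smul, one_smul, map_neg, rootCombination_single, h, neg_neg]
    refine ⟨P.chainBotCoeff i a, P.chainTopCoeff i a, ?_, fun m => ?_⟩
    · rw [corootPairing_eq_pairingIn b i ha, P.chainBotCoeff_sub_chainTopCoeff hlin]
    · rw [← Set.mem_Icc, ← P.root_add_zsmul_mem_range_iff hlin, ha]
      change rootCombination b _ ∈ Set.range P.root ↔ _
      rw [map_add, map_zsmul, rootCombination_single]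

lemma isGenericDatum_cartanMatrix [Finite ι] [P.IsCrystallographic] (b : P.Base)
    {d : b.support → ℕ} (hd : IsSymmetrizer b.cartanMatrix.transpose d) {q : ℂˣ}
    (hq : ∀ n : ℕ, 0 < n → q ^ n ≠ 1) : IsGenericDatum b.cartanMatrix.transpose d (q : ℂ) where
  ne_zero := q.ne_zero
  pow_ne_one n hn h := hq n hn (Units.ext (by simpa using h))
  pos := hd.pos
  symm := hd.symm
  diag i := b.cartanMatrix_apply_same i
  nonpos i j hij := b.cartanMatrix_le_zero_of_ne j i hij.symm

/-- The Borel algebra contains the elements `x̃⁻_{i,1}`. -/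
lemma xTildeMinus_one_mem_borel_of_isMaximalRootWord [Finite ι] [P.IsRootSystem]
    [P.IsCrystallographic] [P.IsReduced] [P.IsIrreducible] (b : P.Base)
    {d : b.support → ℕ} {q : ℂ} (h : IsGenericDatum b.cartanMatrix.transpose d q)
    {l : List b.support} {j₀ : b.support} (hl : IsMaximalRootWord b l j₀) (i : b.support) :
    xTildeMinus b.cartanMatrix.transpose d q i 1 ∈ borel b.cartanMatrix.transpose d q l j₀ := by
  classical
  refine xTildeMinus_one_mem_borel h (isRootSet_rootCoordinates b) ?_ ?_ ?_ i
  · rintro p ⟨i, hi⟩ hp j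
    exact b.induction_on_cartanMatrix p hi hp
  · intro l' hl'
    change rootCombination b _ ∈ Set.range P.root
    rw [rootCombination_wordWeight]
    exact hl.isRoot l' hl'
  · rintro β ⟨a, ha⟩
    obtain ⟨γ, hγ, h1⟩ := exists_rootCombination_eq_of_mem_closure b (hl.highest a)
    rw [← rootCombination_wordWeight, ha, ← map_sub] at h1
    rw [rootCombination_injective b h1] at hγ
    exact sub_nonneg.mp hγ

end Roots

/-! ### Recurrences, joint kernels and linear relations. -/

section LinearAlgebra

/-- A power series whose coefficients satisfy a linear recurrence is rational. -/
lemma isRational_of_recurrence {f : PowerSeries ℂ} {c : ℕ →₀ ℂ} (hc : c ≠ 0)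
    (h : ∀ s : ℕ, (c.sum fun r a => a * PowerSeries.coeff (s + r + 1) f) = 0) : IsRational f := by
  obtain ⟨n, hn⟩ : ∃ n, ∀ r ∈ c.support, r ≤ n :=
    ⟨c.support.sup id, fun r hr => Finset.le_sup (f := id) hr⟩
  -- The denominator `∑ c_r X^{n-r}` reverses the relation: the coefficient of `X^{n+1+s}` in its
  -- product with `f` is the recurrence for `s`, so the product has degree at most `n`.
  refine ⟨PowerSeries.trunc (n + 1) ((∑ r ∈ c.support, Polynomial.monomial (n - r) (c r) :
    Polynomial ℂ) * f), ∑ r ∈ c.support, Polynomial.monomial (n - r) (c r), ?_, ?_⟩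
  · obtain ⟨r, hr⟩ := Finsupp.support_nonempty_iff.mpr hc
    intro h0
    have h1 := congrArg (fun Q => Polynomial.coeff Q (n - r)) h0
    simp only [Polynomial.finsetSum_coeff, Polynomial.coeff_monomial, Polynomial.coeff_zero] at h1
    rw [Finset.sum_eq_single r] at h1
    · simp at h1
      exact (Finsupp.mem_support_iff.mp hr) h1
    · intro r' hr' hne
      have := hn r hr
      have := hn r' hr'
      rw [if_neg (by omega)]
    · exact fun h => absurd hr h
  · ext m
    rw [Polynomial.coeff_coe, PowerSeries.coeff_trunc]
    split_ifs with hm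
    · rfl
    · obtain ⟨s, rfl⟩ := Nat.exists_eq_add_of_le (not_lt.mp hm)
      rw [← h s, Finsupp.sum, ← Polynomial.coeToPowerSeries.ringHom_apply, map_sum,
        Finset.sum_mul, map_sum]
      refine Finset.sum_congr rfl fun r hr => ?_
      have := hn r hr
      rw [Polynomial.coeToPowerSeries.ringHom_apply, Polynomial.coe_monomial,
        PowerSeries.monomial_eq_C_mul_X_pow, mul_assoc, PowerSeries.coeff_C_mul,
        show n + 1 + s = (s + r + 1) + (n - r) by omega, PowerSeries.coeff_X_pow_mul]

variable {V : Type*} [AddCommGroup V] [Module ℂ V]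

/-- Commuting operators that are nilpotent at a non-zero vector have, finitely many at a time, a
non-zero common kernel vector. -/
lemma exists_joint_kernel {J : Type*} (T : J → Module.End ℂ V) (hT : ∀ i j, Commute (T i) (T j))
    {v : V} (hv : v ≠ 0) {p : ℕ} (hp : ∀ j, (T j ^ p) v = 0) (S : Finset J) :
    ∃ w, w ≠ 0 ∧ (∀ j, (T j ^ p) w = 0) ∧ ∀ j ∈ S, T j w = 0 := by
  classical
  induction S using Finset.induction_on with
  | empty => exact ⟨v, hv, hp, by simp⟩
  | insert i S _ ih =>
    obtain ⟨w, hw, hwp, hwS⟩ := ih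
    have hex : ∃ n : ℕ, (T i ^ n) w = 0 := ⟨p, hwp i⟩
    have hspec := Nat.find_spec hex
    have hmin := fun m => Nat.find_min hex (m := m)
    generalize Nat.find hex = n at hspec hmin
    obtain _ | n := n
    · exact absurd (by simpa using hspec) hw
    have hcomm : ∀ (m : ℕ) j, (T j ^ m) w = 0 → (T j ^ m) ((T i ^ n) w) = 0 := by
      intro m j hj
      rw [← Module.End.mul_apply, ((hT j i).pow_pow m n).eq, Module.End.mul_apply, hj, map_zero]
    -- The last non-zero power of `T i` on `w` is killed by `T i`; commutativity preserves the
    -- kernel conditions already obtained.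
    refine ⟨(T i ^ n) w, hmin n (by omega), fun j => hcomm p j (hwp j), fun j hj => ?_⟩
    rcases Finset.mem_insert.mp hj with rfl | hj
    · rwa [pow_succ', Module.End.mul_apply] at hspec
    · simpa using hcomm 1 j (by simpa using hwS j hj)

/-- A sequence of operators restricting to maps between finite dimensional subspaces satisfies a
linear relation on these subspaces. -/
lemma exists_finsupp_relation (W₀ W₁ W₂ : Submodule ℂ V) [FiniteDimensional ℂ W₀]
    [FiniteDimensional ℂ W₁] [FiniteDimensional ℂ W₂] (y : ℕ → Module.End ℂ V)
    (h₁ : ∀ r, ∀ w ∈ W₁, y r w ∈ W₀) (h₀ : ∀ r, ∀ w ∈ W₀, y r w ∈ W₂) :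
    ∃ c : ℕ →₀ ℂ, c ≠ 0 ∧ (∀ w ∈ W₁, (c.sum fun r a => a • y r w) = 0) ∧
      ∀ w ∈ W₀, (c.sum fun r a => a • y r w) = 0 := by
  let g : ℕ → (W₁ →ₗ[ℂ] W₀) × (W₀ →ₗ[ℂ] W₂) := fun r =>
    ((y r).restrict (h₁ r), (y r).restrict (h₀ r))
  -- An infinite sequence in the finite-dimensional product of the two Hom spaces is dependent.
  have hg : ¬ LinearIndependent ℂ g := fun h => by
    have := h.finite
    exact not_finite ℕ
  rw [linearIndependent_iff] at hg
  push Not at hg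
  obtain ⟨c, hc, hc0⟩ := hg
  refine ⟨c, hc0, fun w hw => ?_, fun w hw => ?_⟩
  · have := congrArg (fun F => ((F.1 ⟨w, hw⟩ : W₀) : V)) hc
    simpa [Finsupp.linearCombination_apply, Finsupp.sum, g, Prod.fst_sum] using this
  · have := congrArg (fun F => ((F.2 ⟨w, hw⟩ : W₂) : V)) hc
    simpa [Finsupp.linearCombination_apply, Finsupp.sum, g, Prod.snd_sum] using this

end LinearAlgebra

/-! ### Rationality of `ℓ`-weights. -/

section Rationality

variable {I : Type*} {C : Matrix I I ℤ} {d : I → ℕ} {q : ℂˣ} {l : List I} {j₀ : I}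
  {V : Type*} [AddCommGroup V] [Module ℂ V] [Module (borel C d (q : ℂ) l j₀) V]
  [IsScalarTower ℂ (borel C d (q : ℂ) l j₀) V]

/-- An element of the Borel algebra of weight `μ` maps `V_ω` to `V_{ω μ}`. -/
lemma smul_mem_weightSpace {ω μ : I → ℂˣ} {x : borel C d (q : ℂ) l j₀}
    (hx : ∀ j, kInv C d q j * x = ((μ j)⁻¹ : ℂ) • ((x : LoopAlgebra C d (q : ℂ)) * kInv C d q j))
    {v : V} (hv : v ∈ weightSpace C d q l j₀ V ω) :
    x • v ∈ weightSpace C d q l j₀ V (ω * μ) := by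
  intro j
  have h1 : kBorel C d q l j₀ j * x = (μ j : ℂ) • (x * kBorel C d q l j₀ j) := by
    apply Subtype.ext
    change k C d q j * (x : LoopAlgebra C d (q : ℂ)) =
      (μ j : ℂ) • ((x : LoopAlgebra C d (q : ℂ)) * k C d q j)
    have h2 : (x : LoopAlgebra C d (q : ℂ)) * kInv C d q j =
        (μ j : ℂ) • (kInv C d q j * (x : LoopAlgebra C d (q : ℂ))) := by
      rw [hx, smul_smul, mul_inv_cancel₀ (μ j).ne_zero, one_smul]
    calc k C d q j * (x : LoopAlgebra C d (q : ℂ))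
        = k C d q j * ((x : LoopAlgebra C d (q : ℂ)) * kInv C d q j) * k C d q j := by
          rw [mul_assoc, mul_assoc, kInv_mul_k, mul_one]
      _ = (μ j : ℂ) • (k C d q j * kInv C d q j * (x : LoopAlgebra C d (q : ℂ)) * k C d q j) := by
          rw [h2]
          simp only [mul_smul_comm, smul_mul_assoc, mul_assoc]
      _ = _ := by rw [k_mul_kInv, one_mul]
  have h3 : kBorel C d q l j₀ j • v = (ω j : ℂ) • v := hv j
  rw [← mul_smul, h1, smul_assoc, mul_smul, h3, smul_algebra_smul_comm, smul_smul, mul_comm]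
  simp

lemma phiPlus_comm (i j : I) (m m' : ℕ) :
    phiPlus C d (q : ℂ) i m * phiPlus C d q j m' = phiPlus C d q j m' * phiPlus C d q i m := by
  have hk : ∀ i j m, k C d (q : ℂ) i * phiTilde C d q j m = phiTilde C d q j m * k C d q i := by
    intro i j m
    calc k C d (q : ℂ) i * phiTilde C d q j m
        = k C d q i * (phiTilde C d q j m * kInv C d q i) * k C d q i := by
          rw [mul_assoc, mul_assoc, kInv_mul_k, mul_one]
      _ = _ := by rw [← kInv_phiTilde, ← mul_assoc, k_mul_kInv, one_mul]
  have hkk : k C d (q : ℂ) i * k C d q j = k C d q j * k C d q i := by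
    calc k C d (q : ℂ) i * k C d q j
        = k C d q j * k C d q i * (kInv C d q i * kInv C d q j) * (k C d q i * k C d q j) := by
          rw [mul_assoc (k C d (q : ℂ) j), ← mul_assoc (k C d (q : ℂ) i) (kInv _ _ _ i), k_mul_kInv,
            one_mul, k_mul_kInv, one_mul]
      _ = k C d q j * k C d q i * (kInv C d q j * (kInv C d q i * k C d q i) * k C d q j) := by
          rw [kInv_comm]; simp only [mul_assoc]
      _ = _ := by rw [kInv_mul_k, mul_one, kInv_mul_k, mul_one]
  calc phiPlus C d (q : ℂ) i m * phiPlus C d q j m'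
      = (k C d q i * k C d q j) * (phiTilde C d q i m * phiTilde C d q j m') := by
        rw [phiPlus_eq, phiPlus_eq, mul_assoc, ← mul_assoc (phiTilde _ _ _ _ _), ← hk]
        simp only [mul_assoc]
    _ = (k C d q j * k C d q i) * (phiTilde C d q j m' * phiTilde C d q i m) := by
        rw [hkk, phiTilde_comm]
    _ = _ := by
        rw [phiPlus_eq, phiPlus_eq, mul_assoc, mul_assoc, ← mul_assoc (phiTilde _ _ _ _ _), ← hk]
        simp only [mul_assoc]

/-- If the weight spaces adjacent to an `ℓ`-weight in direction `i` are finite dimensional, then its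
`i`-th component is rational. -/
theorem isRational_of_finiteDimensional [Finite I] (h : IsGenericDatum C d (q : ℂ))
    (hx : ∀ i, xTildeMinus C d (q : ℂ) i 1 ∈ borel C d (q : ℂ) l j₀)
    {Ψ : I → PowerSeries ℂ} (hV : lWeightSpace C d q l j₀ V Ψ ≠ ⊥) {ω : I → ℂˣ}
    (hω : ∀ j, PowerSeries.constantCoeff (Ψ j) = (ω j : ℂ)) (i : I)
    [FiniteDimensional ℂ (weightSpace C d q l j₀ V ω)]
    [FiniteDimensional ℂ (weightSpace C d q l j₀ V (ω * simpleWeight C d q i))]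
    [FiniteDimensional ℂ (weightSpace C d q l j₀ V (ω * (simpleWeight C d q i)⁻¹))] :
    IsRational (Ψ i) := by
  classical
  have := Fintype.ofFinite I
  let xp : ℕ → borel C d (q : ℂ) l j₀ := fun r => ⟨_, xPlus_mem_borel h hx i r⟩
  let xm : ℕ → borel C d (q : ℂ) l j₀ := fun r => ⟨_, xTildeMinus_mem_borel h hx i r⟩
  let ph : I × ℕ → borel C d (q : ℂ) l j₀ := fun t => ⟨_, phiPlus_mem_borel h hx t.1 t.2⟩
  -- The weight `ᾱ_i` is written with `q_i` and `C i j`, the commutation relations with `q_j` and `C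
  -- j i`; the symmetrizer identifies the two.
  have hsw : ∀ j, ((simpleWeight C d q i j : ℂˣ) : ℂ) = ((q : ℂ) ^ d j) ^ C j i := by
    intro j
    have := h.qi_zpow_comm i j 1
    simp only [one_mul] at this
    simp [simpleWeight, this]
  have hxp : ∀ ω r, ∀ v ∈ weightSpace C d q l j₀ V ω,
      xp r • v ∈ weightSpace C d q l j₀ V (ω * simpleWeight C d q i) := by
    refine fun ω r v hv => smul_mem_weightSpace (fun j => ?_) hv
    rw [hsw, ← zpow_neg]
    exact kInv_xPlus C d (q : ℂ) j i r
  have hxm : ∀ ω r, ∀ v ∈ weightSpace C d q l j₀ V ω,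
      xm r • v ∈ weightSpace C d q l j₀ V (ω * (simpleWeight C d q i)⁻¹) := by
    refine fun ω r v hv => smul_mem_weightSpace (fun j => ?_) hv
    rw [Pi.inv_apply, Units.val_inv_eq_inv_val, inv_inv, hsw]
    exact kInv_xTildeMinus C d (q : ℂ) j i _
  let ρ : borel C d (q : ℂ) l j₀ →ₐ[ℂ] Module.End ℂ V := Algebra.lsmul ℂ ℂ V
  have hρ : ∀ b v, ρ b v = b • v := fun _ _ => rfl
  -- The relation is chosen before `s`: it holds on all of `V_{ωᾱ_i}`, hence on every `x⁺_{i,s} w`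
  -- with `w ∈ V_ω`.
  obtain ⟨c, hc0, hc1, hc2⟩ := exists_finsupp_relation (weightSpace C d q l j₀ V ω)
    (weightSpace C d q l j₀ V (ω * simpleWeight C d q i))
    (weightSpace C d q l j₀ V (ω * (simpleWeight C d q i)⁻¹)) (fun r => ρ (xm r))
    (fun r w hw => by simpa [mul_assoc, hρ] using hxm _ r w hw) (fun r w hw => hxm _ r w hw)
  refine isRational_of_recurrence hc0 fun s => ?_
  have hrel : ∀ r, ph (i, s + r + 1) = ((q : ℂ) ^ d i - ((q : ℂ) ^ d i)⁻¹) •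
      (kBorel C d q l j₀ i * (((q : ℂ) ^ d i) ^ (-C i i) • (xp s * xm r) - xm r * xp s)) := by
    intro r
    apply Subtype.ext
    have h1 := xPlus_xTildeMinus_of_pos C d (q : ℂ) i s (r + 1) (by omega)
    change phiPlus C d (q : ℂ) i (s + r + 1) = ((q : ℂ) ^ d i - ((q : ℂ) ^ d i)⁻¹) •
      (k C d q i * (((q : ℂ) ^ d i) ^ (-C i i) • (xPlus C d (q : ℂ) i s *
        xTildeMinus C d (q : ℂ) i (r + 1)) - xTildeMinus C d (q : ℂ) i (r + 1) *
          xPlus C d (q : ℂ) i s))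
    rw [h1, mul_smul_comm, smul_smul, mul_inv_cancel₀ (h.qi_sub_inv_ne_zero i), one_smul,
      phiPlus_eq, show ((s : ℤ) + (r + 1)).toNat = s + r + 1 by omega]
  have hzero : ∀ w ∈ weightSpace C d q l j₀ V ω,
      (c.sum fun r a => a • (ph (i, s + r + 1) • w)) = 0 := by
    intro w hw
    have e1 := hc2 w hw
    have e2 := hc1 _ (hxp ω s w hw)
    simp only [hρ] at e1 e2
    have e3 : (c.sum fun r a => a • (ph (i, s + r + 1) • w)) =
        ((q : ℂ) ^ d i - ((q : ℂ) ^ d i)⁻¹) • ρ (kBorel C d q l j₀ i)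
          (((q : ℂ) ^ d i) ^ (-C i i) • ρ (xp s) (c.sum fun r a => a • (xm r • w)) -
            (c.sum fun r a => a • (xm r • xp s • w))) := by
      simp only [Finsupp.sum, map_sum, Finset.smul_sum, ← Finset.sum_sub_distrib]
      refine Finset.sum_congr rfl fun r _ => ?_
      rw [hrel]
      simp only [← hρ, map_smul, map_mul, map_sub, Module.End.mul_apply, LinearMap.smul_apply,
        LinearMap.sub_apply, smul_sub, smul_smul]
      congr 2 <;> ring
    rw [e3, e1, e2]
    simp
  obtain ⟨v, hv, hv0⟩ := (Submodule.ne_bot_iff _).mp hV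
  obtain ⟨p, hp⟩ := hv
  let T : I × ℕ → Module.End ℂ V := fun t =>
    ρ (ph t - algebraMap ℂ _ (PowerSeries.coeff t.2 (Ψ t.1)))
  have hT : ∀ t t', Commute (T t) (T t') := by
    intro t t'
    have h1 : Commute (ph t) (ph t') := Subtype.ext (phiPlus_comm t.1 t'.1 t.2 t'.2)
    have h2 := ((h1.sub_left (Algebra.commutes (PowerSeries.coeff t.2 (Ψ t.1)) (ph t'))).sub_right
      (Algebra.commutes (PowerSeries.coeff t'.2 (Ψ t'.1))
        (ph t - algebraMap ℂ _ (PowerSeries.coeff t.2 (Ψ t.1)))).symm)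
    exact h2.map ρ
  -- Only finitely many eigenvalue conditions are imposed: those for `φ⁺_{j,0} = k_j`, which put `w`
  -- in `V_ω`, and those for the terms of the recurrence. The vector `w` may depend on `s`, since
  -- the conclusion is about scalars.
  obtain ⟨w, hw0, -, hw⟩ := exists_joint_kernel T hT hv0 (p := p)
    (fun t => by
      rw [← map_pow]
      exact hp t.1 t.2 (ph t) rfl)
    ((Finset.univ.image fun j => (j, 0)) ∪ c.support.image fun r => (i, s + r + 1))
  have heig : ∀ t, T t w = 0 → ph t • w = PowerSeries.coeff t.2 (Ψ t.1) • w := by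
    intro t ht
    change (ph t - algebraMap ℂ _ (PowerSeries.coeff t.2 (Ψ t.1))) • w = 0 at ht
    rwa [sub_smul, algebraMap_smul, sub_eq_zero] at ht
  have hwω : w ∈ weightSpace C d q l j₀ V ω := by
    intro j
    have h1 := heig (j, 0) (hw _ (by simp))
    have h2 : ph (j, 0) = kBorel C d q l j₀ j := by
      apply Subtype.ext
      change phiPlus C d (q : ℂ) j 0 = k C d q j
      rw [phiPlus_eq, phiTilde_zero, mul_one]
    rw [h2] at h1
    rw [h1, ← hω j]
    simp
  have h1 := hzero w hwω
  have h2 : (c.sum fun r a => a • (ph (i, s + r + 1) • w)) =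
      (c.sum fun r a => a * PowerSeries.coeff (s + r + 1) (Ψ i)) • w := by
    rw [Finsupp.sum, Finsupp.sum, Finset.sum_smul]
    refine Finset.sum_congr rfl fun r hr => ?_
    rw [heig (i, s + r + 1) (hw _ (Finset.mem_union_right _ (Finset.mem_image_of_mem _ hr))),
      smul_smul]
  rw [h2, smul_eq_zero] at h1
  exact h1.resolve_right hw0

end Rationality

end

end QuantumLoop

open QuantumLoop in
theorem proposition3p3 {ι M N : Type*} [Finite ι]
    [AddCommGroup M] [Module ℂ M] [AddCommGroup N] [Module ℂ N]
    (P : RootPairing ι ℂ M N) [P.IsRootSystem] [P.IsCrystallographic] [P.IsReduced]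
    [P.IsIrreducible] (b : P.Base)
    (d : b.support → ℕ) (hd : IsSymmetrizer b.cartanMatrix.transpose d)
    (q : ℂˣ) (hq : ∀ n : ℕ, 0 < n → q ^ n ≠ 1)
    (l : List b.support) (j₀ : b.support) (hl : IsMaximalRootWord b l j₀)
    (V : Type*) [AddCommGroup V] [Module ℂ V]
    [Module (borel b.cartanMatrix.transpose d (q : ℂ) l j₀) V]
    [IsScalarTower ℂ (borel b.cartanMatrix.transpose d (q : ℂ) l j₀) V]
    (Ψ : b.support → PowerSeries ℂ) (hΨ : IsLWeight Ψ)
    (hV : lWeightSpace b.cartanMatrix.transpose d q l j₀ V Ψ ≠ ⊥) :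
    (∀ (ω : b.support → ℂˣ) (i : b.support),
      (∀ j, PowerSeries.constantCoeff (Ψ j) = (ω j : ℂ)) →
      FiniteDimensional ℂ (weightSpace b.cartanMatrix.transpose d q l j₀ V ω) →
      FiniteDimensional ℂ (weightSpace b.cartanMatrix.transpose d q l j₀ V
        (ω * simpleWeight b.cartanMatrix.transpose d q i)) →
      FiniteDimensional ℂ (weightSpace b.cartanMatrix.transpose d q l j₀ V
        (ω * (simpleWeight b.cartanMatrix.transpose d q i)⁻¹)) →
      IsRational (Ψ i)) ∧
    (InCategoryO b.cartanMatrix.transpose d q l j₀ V → ∀ i, IsRational (Ψ i)) := by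
  have h := isGenericDatum_cartanMatrix b hd hq
  have hx := xTildeMinus_one_mem_borel_of_isMaximalRootWord b h hl
  refine ⟨fun ω i hω h0 h1 h2 => isRational_of_finiteDimensional h hx hV hω i, fun hO i => ?_⟩
  have := hO.finite
  -- In category `𝒪` every weight space is finite-dimensional, so the first part applies at the
  -- weight of the constant terms, which are units by `hΨ`.
  exact isRational_of_finiteDimensional h hx hV (ω := fun j => Units.mk0 _ (hΨ j))
    (fun j => rfl) i
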